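/- Let $k$ be any commutative ring with identity and let $m\ge 0$. For $i=1,\dots,m$ let $\mathcal C_i$ be a category with $\mathrm{Ob}(\mathcal C_i)=\mathbb N$ such that: (a) $\mathcal C_i(r,n)\neq\emptyset$ if and only if $r\le n$; (b) if $r<l<n$, every morphism $r\to n$ is a composition $r\to l\to n$; (c) every endomorphism is an isomorphism; (d) if $r<n$, the group $\mathcal C_i(n,n)$ acts transitively on $\mathcal C_i(r,n)$. For a category $\mathcal D$ that is one of the $\mathcal C_i$ or the product $\mathcal C=\mathcal C_1\times\cdots\times\mathcal C_m$, a $\mathcal D$-module is a functor $V:\mathcal D\to k\text{-Mod}$, and $M(\mathbf n)=k\mathcal D(\mathbf n,-)$ is the free module at the object $\mathbf n$. The rank of an object is $|\mathbf n|=\sum_i n_i$ (just $n$ for $\mathcal D=\mathcal C_i$), and $\mathbf r\lneqq\mathbf n$ means that $\mathbf r\ne\mathbf n$ and $\mathcal D(\mathbf r,\mathbf n)\neq\emptyset$. Let $H_0(V)$ be the $\mathcal D$-module with $$H_0(V)_{\mathbf n}=V_{\mathbf n}\Big/\sum_{\mathbf r\lneqq\mathbf n}k\mathcal D(\mathbf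 r,\mathbf n)\cdot V_{\mathbf r},$$ let $H_s$ be the $s$-th left derived functor of the right exact functor $H_0$, and put $$\mathrm{hd}_s(V)=\sup\{|\mathbf n| : H_s(V)_{\mathbf n}\ne 0\}\in\{-1\}\cup\mathbb N\cup\{\infty\}\quad(-1\text{ if the set is empty}),\qquad \mathrm{reg}(V)=\sup_{s\in\mathbb N}\,(\mathrm{hd}_s(V)-s).$$ The generation degree of $V$ is $\mathrm{gd}(V)=\mathrm{hd}_0(V)$. The module $V$ is generated in finite degrees if, for some $N\in\mathbb N$, there is a surjection onto $V$ from a direct sum of modules $M(\mathbf n)$ with $|\mathbf n|<N$; it is presented in finite degrees if there is a surjection onto $V$ from a direct sum of modules $M(\mathbf n)$ such that both $V$ and the kernel are generated in finite degrees. Assume further that for every $i$ there are a faithful functor $\psi_i:\mathcal C_i\to\mathcal C_i$ with $\psi_i(n)=n+1$ on objects and a natural transformation $\varepsilon_i:\mathrm{Id}\to\psi_i$ such that, for every $n\in\mathbb N$, the homomorphism $M_i(n)\to M_i(n)\circ\psi_i$ induced by $\varepsilon_i$ (where $M_i(n)=k\mathcal C_i(n,-)$) is injective and its cokernel is a projective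 $\mathcal C_i$-module of generation degree at most $n-1$. Then, for every $\mathcal C$-module $V$, the regularity $\mathrm{reg}(V)$ is finite if and only if $V$ is presented in finite degrees. -/

import Mathlib

open CategoryTheory CategoryTheory.Limits

universe u

noncomputable section

/-- A category whose objects carry a rank in `ℕ` that strictly increases along every morphism
between distinct objects.  In particular `x ≤ y ↔ Nonempty (x ⟶ y)` is a partial order on the
objects, and `x ⪇ y` holds exactly when `x ≠ y` and there is a morphism `x ⟶ y`. -/
class RankedCategory (D : Type) [Category.{u} D] where
  /-- the rank `|x|` of an object -/
  rank : D → ℕ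
  rank_lt : ∀ {x y : D}, (x ⟶ y) → x ≠ y → rank x < rank y

open RankedCategory

/-- An EI category of type `A_∞` satisfying the transitivity condition.  The bijection `deg`
identifies the set of objects with `ℕ`. -/
class TransitiveTypeAInfinity (C : Type) [Category.{u} C] where
  /-- the identification of the objects with the natural numbers -/
  deg : C ≃ ℕ
  nonempty_hom_iff : ∀ r n : C, Nonempty (r ⟶ n) ↔ deg r ≤ deg n
  factors : ∀ r l n : C, deg r < deg l → deg l < deg n → ∀ f : r ⟶ n,
    ∃ (g : r ⟶ l) (h : l ⟶ n), f = g ≫ h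
  isIso_of_endo : ∀ (n : C) (f : n ⟶ n), IsIso f
  transitive : ∀ r n : C, deg r < deg n → ∀ f g : r ⟶ n, ∃ σ : Aut n, f ≫ σ.hom = g

open TransitiveTypeAInfinity

/-- The rank of an object of a category of type `A_∞` is the object itself, seen in `ℕ`. -/
instance TransitiveTypeAInfinity.rankedCategory (C : Type) [Category.{u} C]
    [TransitiveTypeAInfinity C] : RankedCategory C where
  rank := deg
  rank_lt {x y} f h :=
    lt_of_le_of_ne ((nonempty_hom_iff x y).1 ⟨f⟩) fun e => h (deg.injective e)

/-- In a finite product, the rank of `(n_1, …, n_m)` is `n_1 + ⋯ + n_m`. -/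
instance RankedCategory.pi {m : ℕ} (C : Fin m → Type) [∀ i, Category.{u} (C i)]
    [∀ i, RankedCategory (C i)] : RankedCategory (∀ i, C i) where
  rank x := ∑ i, rank (x i)
  rank_lt {x y} f h := by
    obtain ⟨i, hi⟩ := Function.ne_iff.1 h
    refine Finset.sum_lt_sum (fun j _ => ?_) ⟨i, Finset.mem_univ i, rank_lt (f i) hi⟩
    by_cases hj : x j = y j
    · rw [hj]
    · exact (rank_lt (f j) hj).le

section Modules

variable (k : Type u) [CommRing k] {D : Type} [Category.{u} D]

/-- The free module `M(x) = k D(x, -)`. -/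
def freeModule (x : D) : D ⥤ ModuleCat.{u} k :=
  coyoneda.obj (Opposite.op x) ⋙ ModuleCat.free k

variable {k}

/-- The homomorphism `M(x) ⟶ V` that sends the identity of `x` to `v`. -/
def freeModuleDesc {V : D ⥤ ModuleCat.{u} k} {x : D} (v : V.obj x) : freeModule k x ⟶ V where
  app y := ModuleCat.freeDesc (↾ fun f : x ⟶ y => V.map f v)
  naturality y z g := by
    apply ModuleCat.free_hom_ext
    intro f
    simp [freeModule]

/-- A morphism `x ⟶ y`, seen as an element of `M(x)_y`. -/
def freeModuleMk {x y : D} (f : x ⟶ y) : (freeModule k x).obj y :=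
  ModuleCat.freeMk (R := k) (X := x ⟶ y) f

lemma freeModuleDesc_app_id {V : D ⥤ ModuleCat.{u} k} {x : D} (v : V.obj x) :
    (freeModuleDesc v).app x (freeModuleMk (𝟙 x)) = v := by
  refine (ModuleCat.freeDesc_apply (↾ fun f : x ⟶ x => V.map f v) (𝟙 x)).trans ?_
  simp

lemma freeModule_map_id {x y : D} (a : x ⟶ y) :
    (freeModule k x).map a (freeModuleMk (𝟙 x)) = freeModuleMk a := by
  refine (ModuleCat.free_map_apply _ _).trans ?_
  exact congrArg ModuleCat.freeMk (Category.id_comp a)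

lemma freeModule_hom_ext {V : D ⥤ ModuleCat.{u} k} {x : D} {f g : freeModule k x ⟶ V}
    (h : f.app x (freeModuleMk (𝟙 x)) = g.app x (freeModuleMk (𝟙 x))) : f = g := by
  have key : ∀ (f : freeModule k x ⟶ V) (y : D) (a : x ⟶ y),
      f.app y (freeModuleMk a) = V.map a (f.app x (freeModuleMk (𝟙 x))) := by
    intro f y a
    rw [← freeModule_map_id a]
    exact ConcreteCategory.congr_hom (f.naturality a) (freeModuleMk (𝟙 x))
  ext y : 2
  apply ModuleCat.free_hom_ext
  intro a
  exact (key f y a).trans ((congrArg (V.map a) h).trans (key g y a).symm)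

instance freeModule_projective (x : D) : Projective (freeModule k x) where
  factors {E X} f e _ := by
    have : Function.Surjective (e.app x) := (ModuleCat.epi_iff_surjective _).1 inferInstance
    obtain ⟨w, hw⟩ := this (f.app x (freeModuleMk (𝟙 x)))
    refine ⟨freeModuleDesc w, freeModule_hom_ext ?_⟩
    rw [NatTrans.comp_app, ConcreteCategory.comp_apply, freeModuleDesc_app_id, hw]

/-- Needed for the existence of left derived functors. -/
instance enoughProjectives_modules : EnoughProjectives (D ⥤ ModuleCat.{u} k) where
  presentation V := ⟨{
    p := ∐ fun a : Σ x : D, V.obj x => freeModule k a.1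
    f := Sigma.desc fun a => freeModuleDesc a.2
    epi := by
      rw [NatTrans.epi_iff_epi_app]
      intro x
      rw [ModuleCat.epi_iff_surjective]
      intro v
      refine ⟨(Sigma.ι (fun a : Σ x : D, V.obj x => freeModule k a.1) ⟨x, v⟩).app x
        (freeModuleMk (𝟙 x)), ?_⟩
      rw [← ConcreteCategory.comp_apply, ← NatTrans.comp_app, Sigma.ι_desc,
        freeModuleDesc_app_id] }⟩

section Generation

variable [RankedCategory D]

/-- `V` is generated in finite degrees: there are `N` and a surjection onto `V` from a direct sum of
free modules `M(n)` with `|n| < N`. -/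
def GeneratedInFiniteDegrees (V : D ⥤ ModuleCat.{u} k) : Prop :=
  ∃ (N : ℕ) (I : Type u) (n : I → D) (π : (∐ fun i => freeModule k (n i)) ⟶ V),
    (∀ i, rank (n i) < N) ∧ Epi π

/-- `V` is presented in finite degrees: there is a surjection onto `V` from a direct sum of free
modules `M(n)`, such that both `V` and the kernel are generated in finite degrees. -/
def PresentedInFiniteDegrees (V : D ⥤ ModuleCat.{u} k) : Prop :=
  ∃ (I : Type u) (n : I → D) (π : (∐ fun i => freeModule k (n i)) ⟶ V),
    Epi π ∧ GeneratedInFiniteDegrees V ∧ GeneratedInFiniteDegrees (kernel π)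

end Generation

/-- The submodule `∑_{r ⪇ n} k D(r, n) · V_r` of `V_n`. -/
def decomposables (V : D ⥤ ModuleCat.{u} k) (n : D) : Submodule k (V.obj n) :=
  ⨆ (r : D) (_ : r ≠ n) (f : r ⟶ n), LinearMap.range (V.map f).hom

lemma decomposables_le_comap_app {V W : D ⥤ ModuleCat.{u} k} (φ : V ⟶ W) (n : D) :
    decomposables V n ≤ (decomposables W n).comap (φ.app n).hom := by
  refine iSup_le fun r => iSup_le fun hr => iSup_le fun f => ?_
  rintro _ ⟨v, rfl⟩
  refine Submodule.mem_iSup_of_mem r (Submodule.mem_iSup_of_mem hr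
    (Submodule.mem_iSup_of_mem f ⟨φ.app r v, ?_⟩))
  exact (ConcreteCategory.congr_hom (φ.naturality f) v).symm

variable [RankedCategory D]

lemma decomposables_le_comap_map (V : D ⥤ ModuleCat.{u} k) {n l : D} (g : n ⟶ l) :
    decomposables V n ≤ (decomposables V l).comap (V.map g).hom := by
  refine iSup_le fun r => iSup_le fun hr => iSup_le fun f => ?_
  rintro _ ⟨v, rfl⟩
  have hl : r ≠ l := by
    rintro rfl
    exact lt_asymm (rank_lt f hr) (rank_lt g hr.symm)
  refine Submodule.mem_iSup_of_mem r (Submodule.mem_iSup_of_mem hl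
    (Submodule.mem_iSup_of_mem (f ≫ g) ⟨v, ?_⟩))
  simp

variable (k D)

/-- The functor `H_0`, with `H_0(V)_n = V_n / ∑_{r ⪇ n} k D(r, n) · V_r`. -/
def zerothHomology : (D ⥤ ModuleCat.{u} k) ⥤ (D ⥤ ModuleCat.{u} k) where
  obj V :=
    { obj n := ModuleCat.of k (V.obj n ⧸ decomposables V n)
      map {n l} g := ModuleCat.ofHom
        ((decomposables V n).mapQ (decomposables V l) (V.map g).hom
          (decomposables_le_comap_map V g))
      map_id n := by
        ext v
        simp
      map_comp f g := by
        ext v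
        simp }
  map {V W} φ :=
    { app n := ModuleCat.ofHom
        ((decomposables V n).mapQ (decomposables W n) (φ.app n).hom
          (decomposables_le_comap_app φ n))
      naturality n l g := by
        ext v
        have := ConcreteCategory.congr_hom (φ.naturality g) v
        simp_all }
  map_id V := by
    ext n v
    simp
  map_comp φ χ := by
    ext n v
    simp

instance zerothHomology_additive : (zerothHomology k D).Additive where
  map_add {V W φ χ} := by
    ext n : 2
    rw [NatTrans.app_add]
    apply ModuleCat.hom_ext
    apply Submodule.linearMap_qext
    rfl

/-- `H_s`, the `s`-th left derived functor of `H_0`. -/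
def homologyFunctor (s : ℕ) : (D ⥤ ModuleCat.{u} k) ⥤ (D ⥤ ModuleCat.{u} k) :=
  (zerothHomology k D).leftDerived s

variable {k D}

open Classical in
/-- The `s`-th homological degree `hd_s(V) = sup {|n| : H_s(V)_n ≠ 0}`, which is `-1` if this set is
empty and may be `∞`. -/
def homologicalDegree (s : ℕ) (V : D ⥤ ModuleCat.{u} k) : EReal :=
  if ∃ n : D, Nontrivial (((homologyFunctor k D s).obj V).obj n) then
    sSup {d : EReal | ∃ n : D, Nontrivial (((homologyFunctor k D s).obj V).obj n) ∧
      d = (rank n : EReal)}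
  else -1

/-- The generation degree `gd(V) = hd_0(V)`. -/
def generationDegree (V : D ⥤ ModuleCat.{u} k) : EReal := homologicalDegree 0 V

/-- The Castelnuovo-Mumford regularity `reg(V) = sup {hd_s(V) - s : s ∈ ℕ}`. -/
def regularity (V : D ⥤ ModuleCat.{u} k) : EReal :=
  ⨆ s : ℕ, (homologicalDegree s V - (s : EReal))

end Modules

section Shift

variable {k : Type u} [CommRing k] {C : Type} [Category.{u} C]

/-- The homomorphism `V ⟶ V ∘ ψ`, `v ↦ ε_n · v` induced by a natural transformation `ε : Id ⟶ ψ`. -/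
def toShift {ψ : C ⥤ C} (ε : 𝟭 C ⟶ ψ) (V : C ⥤ ModuleCat.{u} k) : V ⟶ ψ ⋙ V where
  app n := V.map (ε.app n)
  naturality n l f := by
    have := ε.naturality f
    simp only [Functor.id_map, Functor.id_obj] at this
    simp [← Functor.map_comp, this]

variable (k)

/-- The conditions on a self-embedding `ψ` of a category of type `A_∞` and on a natural
transformation `ε : Id ⟶ ψ`: `ψ` is faithful with `ψ(n) = n + 1`, and each free module `M(n)` embeds
into its shift, with projective cokernel of generation degree at most `n - 1`. -/
structure IsGenericShift [TransitiveTypeAInfinity C] (ψ : C ⥤ C) (ε : 𝟭 C ⟶ ψ) : Prop where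
  faithful : ψ.Faithful
  deg_obj : ∀ n : C, deg (ψ.obj n) = deg n + 1
  injective : ∀ n : C, Mono (toShift ε (freeModule k n))
  projective : ∀ n : C, Projective (cokernel (toShift ε (freeModule k n)))
  generationDegree_le : ∀ n : C,
    generationDegree (cokernel (toShift ε (freeModule k n))) ≤ (deg n : EReal) - 1

end Shift

end

open CategoryTheory CategoryTheory.Limits

noncomputable section

open RankedCategory
open TransitiveTypeAInfinity

/-! For a shift F that raises coordinate i by one, with η : Id → F, let K V and D V be the kernel
and the cokernel of V → V ∘ F. Two properties of the shift matter (`IsDerivingShift`): K kills free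
modules while D makes them projective, and H_0(V) at F n is H_0(D V) at n. For a free cover 0 → W →
P → V → 0 the snake lemma gives 0 → K V → D W → D P → D V → 0, and dimension shifting turns this
into a long exact sequence … → H_{s+2}(D V)_n → H_s(K V)_n → H_{s+1}(V)_{F n} → H_{s+1}(D V)_n → …
Only its consequences for vanishing are needed: `IsDerivingShift.homologyVanishes_kernel`,
`IsDerivingShift.homologyVanishes_succ` and `IsDerivingShift.homologyVanishes_one_shiftCokernel`.

D lowers the generation degree, which allows induction. K V is annihilated by η, and by transitivity
every morphism that raises coordinate i factors through η; so if K V is generated in ranks below c,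
it vanishes wherever n_i ≥ c (`supportedBelow_ker`). If a module vanishes where the coordinates in a
set S add up to at least t, its H_s vanishes where they add up to at least t + s
(`SupportedBelow.homologyVanishes`).

An object of large rank has a large coordinate, so all hd_s are finite as soon as hd_0 and hd_1 are
(`exists_homologyVanishesFrom`). That bound is a sum over coordinates and may grow too fast in s. A
second induction, on the number of coordinates outside S, gives bounds of the form b + s: for i
outside S the module K_i V has bounded support in S ∪ {i}, D_i V has smaller generation degree, and
an object whose coordinates outside S are all 0 is covered by the support condition.

Finally, presentation in finite degrees is the same as finiteness of hd_0 and hd_1, so the other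
implication is immediate. -/

namespace CategoryTheory

/-! ### Splicing projective resolutions. -/

section Splice

variable {A : Type*} [Category* A] [Abelian A]

/-- The augmentation of a projective resolution. -/
def ProjectiveResolution.aug {X : A} (R : ProjectiveResolution X) : R.complex.X 0 ⟶ X := R.π.f 0

lemma ProjectiveResolution.d_aug {X : A} (R : ProjectiveResolution X) :
    R.complex.d 1 0 ≫ R.aug = 0 := R.complex_d_comp_π_f_zero

instance {X : A} (R : ProjectiveResolution X) : Epi R.aug :=
  inferInstanceAs (Epi (R.π.f 0))

lemma ProjectiveResolution.exact_aug {X : A} (R : ProjectiveResolution X) :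
    (ShortComplex.mk _ _ R.d_aug).Exact := R.exact₀

lemma ProjectiveResolution.exact_aug_comp {S : ShortComplex A} (hS : S.ShortExact)
    (R : ProjectiveResolution S.X₁) :
    (ShortComplex.mk (R.aug ≫ S.f) S.g (by rw [Category.assoc, S.zero, comp_zero])).Exact := by
  let φ : ShortComplex.mk (R.aug ≫ S.f) S.g (by rw [Category.assoc, S.zero, comp_zero]) ⟶ S :=
    { τ₁ := R.aug, τ₂ := 𝟙 _, τ₃ := 𝟙 _ }
  have : Epi φ.τ₁ := inferInstanceAs (Epi R.aug)
  have : IsIso φ.τ₂ := inferInstanceAs (IsIso (𝟙 _))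
  have : Mono φ.τ₃ := inferInstanceAs (Mono (𝟙 _))
  exact (ShortComplex.exact_iff_of_epi_of_isIso_of_mono φ).2 hS.exact

lemma ProjectiveResolution.d_aug_comp {X Y : A} (R : ProjectiveResolution X) (f : X ⟶ Y) :
    R.complex.d 1 0 ≫ R.aug ≫ f = 0 := by
  rw [← Category.assoc, R.d_aug, zero_comp]

lemma ProjectiveResolution.exact_d_aug_comp {X Y : A} (R : ProjectiveResolution X) (f : X ⟶ Y)
    [Mono f] : (ShortComplex.mk _ _ (R.d_aug_comp f)).Exact := by
  let φ : ShortComplex.mk _ _ R.d_aug ⟶ ShortComplex.mk _ _ (R.d_aug_comp f) :=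
    { τ₁ := 𝟙 _, τ₂ := 𝟙 _, τ₃ := f }
  have : Epi φ.τ₁ := inferInstanceAs (Epi (𝟙 _))
  have : IsIso φ.τ₂ := inferInstanceAs (IsIso (𝟙 _))
  have : Mono φ.τ₃ := inferInstanceAs (Mono f)
  exact (ShortComplex.exact_iff_of_epi_of_isIso_of_mono φ).1 R.exact_aug

/-- Splicing a projective resolution of the kernel of an epimorphism from a projective object. -/
def ProjectiveResolution.splice {S : ShortComplex A} (hS : S.ShortExact) [Projective S.X₂]
    (R : ProjectiveResolution S.X₁) : ProjectiveResolution S.X₃ where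
  complex := R.complex.augment (R.aug ≫ S.f) (R.d_aug_comp S.f)
  projective n := by
    cases n
    · exact inferInstanceAs (Projective S.X₂)
    · exact R.projective _
  π := (ChainComplex.toSingle₀Equiv _ _).symm ⟨S.g, by
    refine Eq.trans ?_ (comp_zero (f := R.aug))
    rw [← S.zero, ← Category.assoc]
    rfl⟩
  quasiIso := ⟨fun n => by
    have := hS.epi_g
    have := hS.mono_f
    obtain _ | n := n
    · rw [ChainComplex.quasiIsoAt₀_iff, ShortComplex.quasiIso_iff_of_zeros']
      · refine (ShortComplex.exact_and_epi_g_iff_of_iso ?_).2 ⟨R.exact_aug_comp hS, hS.epi_g⟩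
        refine ShortComplex.isoMk (Iso.refl _) (Iso.refl _) (Iso.refl _) ?_ ?_
        · exact (Category.id_comp _).trans (Category.comp_id _).symm
        · refine (Category.id_comp _).trans (Eq.trans ?_ (Category.comp_id _).symm)
          exact (ChainComplex.toSingle₀Equiv_symm_apply_f_zero
            (C := R.complex.augment (R.aug ≫ S.f) _) S.g _).symm
      all_goals rfl
    · rw [quasiIsoAt_iff_exactAt']
      · rw [HomologicalComplex.exactAt_iff' _ (n + 1 + 1) (n + 1) n (by simp) (by simp)]
        obtain _ | n := n
        · exact R.exact_d_aug_comp S.f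
        · exact R.exact_succ n
      · apply ChainComplex.exactAt_succ_single_obj⟩

end Splice

/-! ### Dimension shifting and the long exact sequence, as statements about vanishing. -/

section LeftDerived

variable {A : Type*} [Category* A] [Abelian A] [EnoughProjectives A]
variable {B : Type*} [Category* B] [Abelian B] (F : A ⥤ B) [F.Additive]

lemma Functor.isZero_leftDerived_succ_iff {X : A} (P : ProjectiveResolution X) (n : ℕ) :
    IsZero ((F.leftDerived (n + 1)).obj X) ↔
      ((ShortComplex.mk _ _ (P.complex.d_comp_d (n + 2) (n + 1) n)).map F).Exact := by
  rw [(P.isoLeftDerivedObj F (n + 1)).isZero_iff]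
  erw [← HomologicalComplex.exactAt_iff_isZero_homology]
  rw [HomologicalComplex.exactAt_iff' _ (n + 2) (n + 1) n (by simp) (by simp)]
  rfl

lemma Functor.isZero_leftDerived_zero_iff [PreservesFiniteColimits F] (X : A) :
    IsZero ((F.leftDerived 0).obj X) ↔ IsZero (F.obj X) :=
  (F.leftDerivedZeroIsoSelf.app X).isZero_iff

/-- Above degree 0 the spliced resolution is the resolution of the kernel moved up by one, so both
sides assert exactness of the same complex. -/
lemma Functor.isZero_leftDerived_add_two_iff {S : ShortComplex A} (hS : S.ShortExact)
    [Projective S.X₂] (n : ℕ) :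
    IsZero ((F.leftDerived (n + 2)).obj S.X₃) ↔ IsZero ((F.leftDerived (n + 1)).obj S.X₁) := by
  let R := projectiveResolution S.X₁
  rw [F.isZero_leftDerived_succ_iff R, F.isZero_leftDerived_succ_iff (R.splice hS)]
  rfl

end LeftDerived

section RightExact

variable {A : Type*} [Category* A] {R : Type*} [Ring R] (F : A ⥤ ModuleCat R)

lemma Functor.exists_map_eq_of_exact [Abelian A] [F.Additive] [PreservesFiniteColimits F]
    {S : ShortComplex A} (hS : S.Exact) [Epi S.g]
    {y : F.obj S.X₂} (hy : F.map S.g y = 0) : ∃ x, F.map S.f x = y :=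
  (S.map F).moduleCat_exact_iff.1 (hS.map_of_epi_of_preservesCokernel F ‹_› inferInstance) y hy

lemma Functor.map_surjective_of_epi [PreservesFiniteColimits F] {X Y : A} (f : X ⟶ Y) [Epi f] :
    Function.Surjective (F.map f) :=
  (ModuleCat.epi_iff_surjective _).1 inferInstance

lemma Functor.map_map_eq_zero [HasZeroMorphisms A] [F.PreservesZeroMorphisms] {X Y Z : A}
    {f : X ⟶ Y} {g : Y ⟶ Z} (w : f ≫ g = 0) (x : F.obj X) : F.map g (F.map f x) = 0 := by
  rw [← ConcreteCategory.comp_apply, ← F.map_comp, w, F.map_zero]; rfl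

end RightExact

section LongExactSequence

variable {A : Type*} [Category* A] [Abelian A] [EnoughProjectives A] {R : Type*} [Ring R]
variable (F : A ⥤ ModuleCat R) [F.Additive] [PreservesFiniteColimits F]

/-- The first derived functor of the quotient is the kernel of `F.map S.f`: the spliced resolution
starts with `R.aug ≫ S.f`, and right exactness makes `F.obj S.X₁` the cokernel of the preceding
differential. -/
lemma Functor.isZero_leftDerived_one_iff {S : ShortComplex A}
    (hS : S.ShortExact) [Projective S.X₂] :
    IsZero ((F.leftDerived 1).obj S.X₃) ↔ Mono (F.map S.f) := by
  let P := projectiveResolution S.X₁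
  rw [F.isZero_leftDerived_succ_iff (P.splice hS)]
  have hd : ∀ y : F.obj (P.complex.X 0), F.map (P.aug) y = 0 →
      ∃ x, F.map (P.complex.d 1 0) x = y :=
    fun y hy => F.exists_map_eq_of_exact P.exact_aug hy
  have hs : Function.Surjective (F.map (P.aug)) := F.map_surjective_of_epi _
  have hc (y) : F.map (P.aug) (F.map (P.complex.d 1 0) y) = 0 :=
    F.map_map_eq_zero P.d_aug y
  have hf (y) : F.map (P.aug ≫ S.f) y = F.map S.f (F.map (P.aug) y) :=
    ConcreteCategory.congr_hom (F.map_comp (Y := S.X₁) (P.aug) S.f) y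
  rw [ShortComplex.moduleCat_exact_iff, ModuleCat.mono_iff_injective,
    injective_iff_map_eq_zero]
  constructor
  · intro h a ha
    obtain ⟨y, rfl⟩ := hs a
    obtain ⟨x, rfl⟩ := h y ((hf y).trans ha)
    exact hc x
  · intro h y hy
    exact hd y (h _ ((hf y).symm.trans hy))

lemma Functor.mono_map_of_isZero_leftDerived_one {S : ShortComplex A} (hS : S.ShortExact)
    (h : IsZero ((F.leftDerived 1).obj S.X₃)) : Mono (F.map S.f) := by
  have := hS.epi_g
  have := hS.mono_f
  let p := Projective.π S.X₃
  let l := Projective.factorThru p S.g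
  have hl : l ≫ S.g = p := Projective.factorThru_comp _ _
  have hp : (ShortComplex.mk _ _ (kernel.condition p)).ShortExact :=
    { exact := ShortComplex.exact_kernel p }
  have : Projective (ShortComplex.mk _ _ (kernel.condition p)).X₂ :=
    inferInstanceAs (Projective (Projective.over S.X₃))
  have hι : Mono (F.map (kernel.ι p)) := (F.isZero_leftDerived_one_iff hp).1 h
  let w : Limits.kernel p ⟶ S.X₁ := hS.exact.lift (kernel.ι p ≫ l) (by simp [hl])
  have hw : w ≫ S.f = kernel.ι p ≫ l := hS.exact.lift_f _ _
  -- `S.X₂` is the quotient of `S.X₁ ⊞ P` by the kernel of `p`, embedded antidiagonally. Right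
  -- exactness of `F` preserves this presentation, so an element killed by `F.map S.f` comes from an
  -- element of `F (kernel p)` that dies in `F P`, hence is 0.
  let T := ShortComplex.mk (biprod.lift w (-kernel.ι p)) (biprod.desc S.f l) (by simp [hw])
  have hT : T.Exact := by
    rw [ShortComplex.exact_iff_exact_up_to_refinements]
    intro X x hx
    have e : x = biprod.lift (x ≫ biprod.fst) (x ≫ biprod.snd) := by
      apply biprod.hom_ext <;> simp
    have h1 : (x ≫ biprod.fst) ≫ S.f + (x ≫ biprod.snd) ≫ l = 0 := by
      rw [e] at hx
      simpa [T] using hx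
    have h2 : (x ≫ biprod.snd) ≫ p = 0 := by
      have := congrArg (· ≫ S.g) h1
      simpa [hl] using this
    refine ⟨X, 𝟙 _, inferInstance, -kernel.lift p _ h2, ?_⟩
    have h3 : x ≫ biprod.fst = -kernel.lift p _ h2 ≫ w := by
      rw [← cancel_mono S.f, Preadditive.neg_comp, Category.assoc (kernel.lift _ _ _), hw,
        kernel.lift_ι_assoc]
      exact eq_neg_of_add_eq_zero_left h1
    apply biprod.hom_ext
    · simpa [T] using h3
    · simp [T]
  have : Epi T.g := by
    refine Preadditive.epi_of_cancel_zero _ fun {X} u hu => ?_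
    have h1 : S.f ≫ u = 0 := by simpa [T] using congrArg (biprod.inl ≫ ·) hu
    have h2 : l ≫ u = 0 := by simpa [T] using congrArg (biprod.inr ≫ ·) hu
    have h3 : p ≫ hS.exact.desc u h1 = 0 := by rw [← hl, Category.assoc, hS.exact.g_desc, h2]
    rw [← hS.exact.g_desc u h1, zero_of_epi_comp p h3, comp_zero]
  rw [ModuleCat.mono_iff_injective, injective_iff_map_eq_zero] at hι ⊢
  intro a ha
  have inl_inj : Function.Injective (F.map (biprod.inl : S.X₁ ⟶ S.X₁ ⊞ Projective.over S.X₃)) :=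
    (ModuleCat.mono_iff_injective _).1 inferInstance
  obtain ⟨y, hy⟩ := F.exists_map_eq_of_exact hT (y := F.map biprod.inl a) (by
    rw [← ConcreteCategory.comp_apply, ← F.map_comp]
    simpa [T] using ha)
  have hy0 : F.map (-kernel.ι p) y = 0 := by
    have := congrArg (F.map biprod.snd) hy
    rw [← ConcreteCategory.comp_apply, ← ConcreteCategory.comp_apply, ← F.map_comp,
      ← F.map_comp] at this
    simpa [T] using this
  have : y = 0 := hι y (by
    rw [F.map_neg] at hy0
    simpa using hy0)
  rw [this, map_zero] at hy
  exact inl_inj (by rw [← hy, map_zero])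

/-- With one projective cover `Q` of the middle term, the syzygies `B` of `S.X₂` and `C` of `S.X₃`
fit into 0 → B → C → `S.X₁` → 0. Rotating the sequence in this way lowers homological degrees by
one. -/
lemma ShortComplex.ShortExact.exists_rotation {S : ShortComplex A} (hS : S.ShortExact) :
    ∃ (Q B C : A) (i : B ⟶ Q) (q : Q ⟶ S.X₂) (w : i ≫ q = 0) (j : C ⟶ Q)
      (w' : j ≫ q ≫ S.g = 0) (u : B ⟶ C) (v : C ⟶ S.X₁) (w'' : u ≫ v = 0),
      Projective Q ∧ (ShortComplex.mk i q w).ShortExact ∧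
      (ShortComplex.mk j (q ≫ S.g) w').ShortExact ∧ (ShortComplex.mk u v w'').ShortExact ∧
      u ≫ j = i ∧ v ≫ S.f = j ≫ q := by
  have := hS.epi_g
  have := hS.mono_f
  let q := Projective.π S.X₂
  let u : kernel q ⟶ kernel (q ≫ S.g) := kernel.lift _ (kernel.ι q) (by simp)
  let v : kernel (q ≫ S.g) ⟶ S.X₁ := hS.exact.lift (kernel.ι (q ≫ S.g) ≫ q) (by
    rw [Category.assoc, kernel.condition])
  have hu : u ≫ kernel.ι _ = kernel.ι q := kernel.lift_ι _ _ _
  have hv : v ≫ S.f = kernel.ι (q ≫ S.g) ≫ q := hS.exact.lift_f _ _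
  have huv : u ≫ v = 0 := by
    rw [← cancel_mono S.f, Category.assoc, hv, ← Category.assoc, hu, kernel.condition, zero_comp]
  refine ⟨_, _, _, kernel.ι q, q, kernel.condition q, kernel.ι (q ≫ S.g), kernel.condition _,
    u, v, huv, inferInstance,
    { exact := ShortComplex.exact_kernel q },
    { exact := ShortComplex.exact_kernel (q ≫ S.g), epi_g := epi_comp q S.g },
    { exact := ?_, mono_f := ?_, epi_g := ?_ }, hu, hv⟩
  · rw [ShortComplex.exact_iff_exact_up_to_refinements]
    intro X x hx
    dsimp at x hx
    refine ⟨X, 𝟙 _, inferInstance, kernel.lift q (x ≫ kernel.ι _) ?_, ?_⟩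
    · rw [Category.assoc, ← hv, reassoc_of% hx, zero_comp]
    · rw [← cancel_mono (kernel.ι _)]
      simp [hu]
  · dsimp
    have : Mono (u ≫ kernel.ι _) := by rw [hu]; infer_instance
    exact mono_of_mono u (kernel.ι _)
  · dsimp
    rw [epi_iff_surjective_up_to_refinements]
    intro X a
    obtain ⟨X', π, hπ, b, hb⟩ := surjective_up_to_refinements_of_epi q (a ≫ S.f)
    refine ⟨X', π, hπ, kernel.lift _ b ?_, ?_⟩
    · rw [← Category.assoc, ← hb]
      simp
    · rw [← cancel_mono S.f, Category.assoc, Category.assoc, hv, kernel.lift_ι_assoc, ← hb]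

variable {F}

lemma Functor.isZero_leftDerived_one_of_mono {S : ShortComplex A} (hS : S.ShortExact)
    (h₂ : IsZero ((F.leftDerived 1).obj S.X₂)) (h : Mono (F.map S.f)) :
    IsZero ((F.leftDerived 1).obj S.X₃) := by
  obtain ⟨Q, B, C, i, q, w, j, w', u, v, w'', hQ, hB, hC, hA, hu, hv⟩ := hS.exists_rotation
  have : Projective (ShortComplex.mk j (q ≫ S.g) w').X₂ := hQ
  have : Projective (ShortComplex.mk i q w).X₂ := hQ
  have := hA.epi_g
  refine (F.isZero_leftDerived_one_iff hC).2 ?_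
  have hi := (F.isZero_leftDerived_one_iff hB).1 h₂
  dsimp only at hi ⊢
  rw [ModuleCat.mono_iff_injective, injective_iff_map_eq_zero] at h hi ⊢
  intro x hx
  obtain ⟨y, rfl⟩ := F.exists_map_eq_of_exact hA.exact (y := x) (h _ (by
    dsimp only
    rw [← ConcreteCategory.comp_apply, ← F.map_comp, hv, F.map_comp, ConcreteCategory.comp_apply,
      hx, map_zero]))
  dsimp only at hx y ⊢
  rw [← ConcreteCategory.comp_apply, ← F.map_comp, hu] at hx
  rw [hi y hx, map_zero]

lemma mono_of_isZero_moduleCat {X Y : ModuleCat R} (f : X ⟶ Y) (h : IsZero X) : Mono f :=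
  ⟨fun _ _ _ => h.eq_of_tgt _ _⟩

variable (F) in
/-- Three consecutive pieces of the long exact sequence, as far as vanishing is concerned. -/
def Functor.LeftDerivedVanishing (s : ℕ) : Prop :=
  ∀ S : ShortComplex A, S.ShortExact →
    (IsZero ((F.leftDerived s).obj S.X₁) → IsZero ((F.leftDerived s).obj S.X₃) →
      IsZero ((F.leftDerived s).obj S.X₂)) ∧
    (IsZero ((F.leftDerived (s + 1)).obj S.X₃) → IsZero ((F.leftDerived s).obj S.X₂) →
      IsZero ((F.leftDerived s).obj S.X₁)) ∧
    (IsZero ((F.leftDerived (s + 1)).obj S.X₂) → IsZero ((F.leftDerived s).obj S.X₁) →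
      IsZero ((F.leftDerived (s + 1)).obj S.X₃))

lemma Functor.leftDerivedVanishing_zero : F.LeftDerivedVanishing 0 := by
  intro S hS
  have := hS.epi_g
  simp only [F.isZero_leftDerived_zero_iff]
  refine ⟨fun h₁ h₃ => ?_, fun h₃ h₂ => ?_, fun h₂ h₁ => ?_⟩
  · exact (hS.exact.map_of_epi_of_preservesCokernel F ‹_› inferInstance).isZero_of_both_zeros
      (h₁.eq_of_src _ _) (h₃.eq_of_tgt _ _)
  · have := F.mono_map_of_isZero_leftDerived_one hS h₃
    exact h₂.of_mono (F.map S.f)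
  · exact isZero_leftDerived_one_of_mono hS h₂ (mono_of_isZero_moduleCat _ h₁)

/-- Rotation turns the middle statement in one degree into the left statement one degree lower, the
left into the right, and the right into the middle statement in the same degree. In degree one the
syzygies are controlled by monomorphisms under `F`, so that case is argued separately. -/
lemma Functor.leftDerivedVanishing_succ (s : ℕ) : F.LeftDerivedVanishing (s + 1) := by
  induction s with
  | zero =>
    have key : ∀ S : ShortComplex A, S.ShortExact → IsZero ((F.leftDerived 1).obj S.X₁) →
        IsZero ((F.leftDerived 1).obj S.X₃) → IsZero ((F.leftDerived 1).obj S.X₂) := by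
      intro S hS h₁ h₃
      obtain ⟨Q, B, C, i, q, w, j, w', u, v, w'', hQ, hB, hC, hA, hu, hv⟩ := hS.exists_rotation
      have : Projective (ShortComplex.mk j (q ≫ S.g) w').X₂ := hQ
      have : Projective (ShortComplex.mk i q w).X₂ := hQ
      have m1 : Mono (F.map u) := F.mono_map_of_isZero_leftDerived_one hA h₁
      have m2 : Mono (F.map j) := (F.isZero_leftDerived_one_iff hC).1 h₃
      refine (F.isZero_leftDerived_one_iff hB).2 ?_
      dsimp only
      rw [← hu, F.map_comp]
      infer_instance
    intro S hS
    obtain ⟨Q, B, C, i, q, w, j, w', u, v, w'', hQ, hB, hC, hA, hu, hv⟩ := hS.exists_rotation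
    have : Projective (ShortComplex.mk j (q ≫ S.g) w').X₂ := hQ
    have : Projective (ShortComplex.mk i q w).X₂ := hQ
    have eB := F.isZero_leftDerived_add_two_iff hB 0
    have eC := F.isZero_leftDerived_add_two_iff hC 0
    refine ⟨key S hS, fun h₃ h₂ => ?_, fun h₂ h₁ => ?_⟩
    · have hi := (F.isZero_leftDerived_one_iff hB).1 h₂
      dsimp only at hi
      rw [← hu, F.map_comp] at hi
      exact isZero_leftDerived_one_of_mono hA (eC.1 h₃) (mono_of_mono (F.map u) (F.map j))
    · exact eC.2 (key _ hA (eB.1 h₂) h₁)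
  | succ s ih =>
    have key : ∀ S : ShortComplex A, S.ShortExact → IsZero ((F.leftDerived (s + 2)).obj S.X₁) →
        IsZero ((F.leftDerived (s + 2)).obj S.X₃) → IsZero ((F.leftDerived (s + 2)).obj S.X₂) := by
      intro S hS h₁ h₃
      obtain ⟨Q, B, C, i, q, w, j, w', u, v, w'', hQ, hB, hC, hA, hu, hv⟩ := hS.exists_rotation
      have : Projective (ShortComplex.mk j (q ≫ S.g) w').X₂ := hQ
      have : Projective (ShortComplex.mk i q w).X₂ := hQ
      exact (F.isZero_leftDerived_add_two_iff hB s).2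
        ((ih _ hA).2.1 h₁ ((F.isZero_leftDerived_add_two_iff hC s).1 h₃))
    intro S hS
    obtain ⟨Q, B, C, i, q, w, j, w', u, v, w'', hQ, hB, hC, hA, hu, hv⟩ := hS.exists_rotation
    have : Projective (ShortComplex.mk j (q ≫ S.g) w').X₂ := hQ
    have : Projective (ShortComplex.mk i q w).X₂ := hQ
    refine ⟨key S hS, fun h₃ h₂ => ?_, fun h₂ h₁ => ?_⟩
    · exact (ih _ hA).2.2 ((F.isZero_leftDerived_add_two_iff hC (s + 1)).1 h₃)
        ((F.isZero_leftDerived_add_two_iff hB s).1 h₂)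
    · exact (F.isZero_leftDerived_add_two_iff hC (s + 1)).2
        (key _ hA ((F.isZero_leftDerived_add_two_iff hB (s + 1)).1 h₂) h₁)

variable (F) in
lemma Functor.leftDerivedVanishing (s : ℕ) : F.LeftDerivedVanishing s := by
  cases s
  · exact leftDerivedVanishing_zero
  · exact leftDerivedVanishing_succ _

end LongExactSequence

end CategoryTheory

/-! ### Homology at a single object. -/

section HomologyAt

/-- An exact functor commutes with the homology of the resolution. Applied to evaluation at an
object, this lets all later arguments take place in modules over `k`. -/
lemma isZero_map_leftDerived_iff {A B E : Type*} [Category* A] [Category* B] [Category* E]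
    [Abelian A] [Abelian B] [Abelian E] [EnoughProjectives A] (F : A ⥤ B) [F.Additive]
    (G : B ⥤ E) [G.Additive] [G.PreservesHomology] (s : ℕ) (X : A) :
    IsZero (G.obj ((F.leftDerived s).obj X)) ↔ IsZero (((F ⋙ G).leftDerived s).obj X) := by
  let P := projectiveResolution X
  have e₁ := G.mapIso (P.isoLeftDerivedObj F s)
  have e₂ := P.isoLeftDerivedObj (F ⋙ G) s
  have e₃ := ((((F.mapHomologicalComplex (ComplexShape.down ℕ)).obj P.complex).sc s).mapHomologyIso
    G)
  rw [e₁.isZero_iff, e₂.isZero_iff]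
  exact e₃.symm.isZero_iff

variable {k : Type u} [CommRing k] {D : Type} [Category.{u} D] [RankedCategory D]

/-- The functor `V ↦ H_0(V)_n`. -/
abbrev zerothHomologyAt (k : Type u) [CommRing k] {D : Type} [Category.{u} D] [RankedCategory D]
    (n : D) : (D ⥤ ModuleCat.{u} k) ⥤ ModuleCat.{u} k :=
  zerothHomology k D ⋙ (evaluation D (ModuleCat.{u} k)).obj n

instance (n : D) : (zerothHomologyAt k n).Additive := by unfold zerothHomologyAt; infer_instance

/-- `H_s(V)_n = 0`. -/
def HomologyVanishes (s : ℕ) (V : D ⥤ ModuleCat.{u} k) (n : D) : Prop :=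
  IsZero (((zerothHomologyAt k n).leftDerived s).obj V)

lemma homologyVanishes_iff (s : ℕ) (V : D ⥤ ModuleCat.{u} k) (n : D) :
    HomologyVanishes s V n ↔ ¬ Nontrivial (((homologyFunctor k D s).obj V).obj n) := by
  rw [not_nontrivial_iff_subsingleton, ← ModuleCat.isZero_iff_subsingleton]
  exact (isZero_map_leftDerived_iff (zerothHomology k D)
    ((evaluation D (ModuleCat.{u} k)).obj n) s V).symm

end HomologyAt

/-! ### Right exactness of H_0 and vanishing in short exact sequences. -/

section RightExactness

variable {k : Type u} [CommRing k] {D : Type} [Category.{u} D]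

lemma app_surjective_of_epi {V W : D ⥤ ModuleCat.{u} k} (φ : V ⟶ W) [Epi φ] (n : D) :
    Function.Surjective (φ.app n) :=
  (ModuleCat.epi_iff_surjective _).1 inferInstance

lemma app_injective_of_mono {V W : D ⥤ ModuleCat.{u} k} (φ : V ⟶ W) [Mono φ] (n : D) :
    Function.Injective (φ.app n) :=
  (ModuleCat.mono_iff_injective _).1 inferInstance

lemma exists_app_eq_of_exact {S : ShortComplex (D ⥤ ModuleCat.{u} k)} (hS : S.Exact) (n : D)
    {v : S.X₂.obj n} (hv : S.g.app n v = 0) : ∃ u, S.f.app n u = v :=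
  (S.map ((evaluation D (ModuleCat.{u} k)).obj n)).moduleCat_exact_iff.1
    (hS.map ((evaluation D (ModuleCat.{u} k)).obj n)) v hv

lemma decomposables_eq_map_of_epi {V W : D ⥤ ModuleCat.{u} k} (φ : V ⟶ W) [Epi φ] (n : D) :
    decomposables W n = (decomposables V n).map (φ.app n).hom := by
  refine le_antisymm ?_ (Submodule.map_le_iff_le_comap.2 (decomposables_le_comap_app φ n))
  refine iSup_le fun r => iSup_le fun hr => iSup_le fun f => ?_
  rintro _ ⟨w, rfl⟩
  obtain ⟨v, rfl⟩ := app_surjective_of_epi φ r w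
  exact ⟨V.map f v, Submodule.mem_iSup_of_mem r (Submodule.mem_iSup_of_mem hr
    (Submodule.mem_iSup_of_mem f ⟨v, rfl⟩)), ConcreteCategory.congr_hom (φ.naturality f) v⟩

variable [RankedCategory D]

instance (n : D) : PreservesFiniteColimits (zerothHomologyAt k n) := by
  refine ((Functor.preservesFiniteColimits_tfae (zerothHomologyAt k n)).out 0 3).1 ?_
  intro S hS
  have := hS.epi_g
  constructor
  · rw [ShortComplex.moduleCat_exact_iff]
    intro x hx
    obtain ⟨x, rfl⟩ := Submodule.mkQ_surjective _ x
    have h1 : S.g.app n x ∈ decomposables S.X₃ n :=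
      (Submodule.Quotient.mk_eq_zero _).1 hx
    rw [decomposables_eq_map_of_epi S.g n] at h1
    obtain ⟨y, hy, hyx⟩ := h1
    obtain ⟨z, hz⟩ := exists_app_eq_of_exact hS.exact n (v := x - y) (by
      rw [map_sub, sub_eq_zero]; exact hyx.symm)
    refine ⟨(decomposables S.X₁ n).mkQ z, ?_⟩
    change (decomposables S.X₂ n).mkQ (S.f.app n z) = (decomposables S.X₂ n).mkQ x
    rw [hz, map_sub]
    have : (decomposables S.X₂ n).mkQ y = 0 := (Submodule.Quotient.mk_eq_zero _).2 hy
    rw [this, sub_zero]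
  · rw [ModuleCat.epi_iff_surjective]
    intro x
    obtain ⟨x, rfl⟩ := Submodule.mkQ_surjective _ x
    obtain ⟨y, rfl⟩ := app_surjective_of_epi S.g n x
    exact ⟨(decomposables S.X₂ n).mkQ y, rfl⟩

lemma isZero_zerothHomologyAt_iff (V : D ⥤ ModuleCat.{u} k) (n : D) :
    IsZero ((zerothHomologyAt k n).obj V) ↔ decomposables V n = ⊤ :=
  ModuleCat.isZero_iff_subsingleton.trans Submodule.Quotient.subsingleton_iff

lemma homologyVanishes_zero_iff_isZero (V : D ⥤ ModuleCat.{u} k) (n : D) :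
    HomologyVanishes 0 V n ↔ IsZero ((zerothHomologyAt k n).obj V) :=
  (zerothHomologyAt k n).isZero_leftDerived_zero_iff V

lemma homologyVanishes_zero_iff (V : D ⥤ ModuleCat.{u} k) (n : D) :
    HomologyVanishes 0 V n ↔ decomposables V n = ⊤ :=
  (homologyVanishes_zero_iff_isZero V n).trans (isZero_zerothHomologyAt_iff V n)

variable {S : ShortComplex (D ⥤ ModuleCat.{u} k)} (hS : S.ShortExact) (n : D)
include hS

lemma homologyVanishes_one_iff [Projective S.X₂] :
    HomologyVanishes 1 S.X₃ n ↔ Mono ((zerothHomologyAt k n).map S.f) :=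
  (zerothHomologyAt k n).isZero_leftDerived_one_iff hS

lemma homologyVanishes_add_two_iff [Projective S.X₂] (s : ℕ) :
    HomologyVanishes (s + 2) S.X₃ n ↔ HomologyVanishes (s + 1) S.X₁ n :=
  (zerothHomologyAt k n).isZero_leftDerived_add_two_iff hS s

lemma mono_of_homologyVanishes_one (h : HomologyVanishes 1 S.X₃ n) :
    Mono ((zerothHomologyAt k n).map S.f) :=
  (zerothHomologyAt k n).mono_map_of_isZero_leftDerived_one hS h

lemma homologyVanishes_middle {s : ℕ} (h₁ : HomologyVanishes s S.X₁ n)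
    (h₃ : HomologyVanishes s S.X₃ n) : HomologyVanishes s S.X₂ n :=
  ((zerothHomologyAt k n).leftDerivedVanishing s S hS).1 h₁ h₃

lemma homologyVanishes_left {s : ℕ} (h₃ : HomologyVanishes (s + 1) S.X₃ n)
    (h₂ : HomologyVanishes s S.X₂ n) : HomologyVanishes s S.X₁ n :=
  ((zerothHomologyAt k n).leftDerivedVanishing s S hS).2.1 h₃ h₂

lemma mono_zerothHomologyAt_of_homologyVanishes_zero (h : HomologyVanishes 0 S.X₁ n) :
    Mono ((zerothHomologyAt k n).map S.g) :=
  (hS.exact.map_of_epi_of_preservesCokernel (zerothHomologyAt k n) hS.epi_g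
    inferInstance).mono_g
      ((((zerothHomologyAt k n).isZero_leftDerived_zero_iff _).1 h).eq_of_src _ _)

end RightExactness

/-! ### The snake lemma with injective middle map. -/

section Snake

variable {A : Type*} [Category* A] [Abelian A]

/-- The snake lemma for a morphism of short exact sequences, with chosen kernels and cokernels. -/
def snakeInputOfHom {S T : ShortComplex A} (φ : S ⟶ T) (hS : S.ShortExact) (hT : T.ShortExact) :
    ShortComplex.SnakeInput A where
  L₀ := ShortComplex.mk (kernel.map φ.τ₁ φ.τ₂ S.f T.f φ.comm₁₂)
    (kernel.map φ.τ₂ φ.τ₃ S.g T.g φ.comm₂₃) (by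
      rw [← cancel_mono (kernel.ι _)]
      simp)
  L₁ := S
  L₂ := T
  L₃ := ShortComplex.mk (cokernel.map φ.τ₁ φ.τ₂ S.f T.f φ.comm₁₂)
    (cokernel.map φ.τ₂ φ.τ₃ S.g T.g φ.comm₂₃) (by
      rw [← cancel_epi (cokernel.π _)]
      simp)
  v₀₁ := { τ₁ := kernel.ι _, τ₂ := kernel.ι _, τ₃ := kernel.ι _ }
  v₁₂ := φ
  v₂₃ := { τ₁ := cokernel.π _, τ₂ := cokernel.π _, τ₃ := cokernel.π _ }
  h₀ := ShortComplex.isLimitOfIsLimitπ _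
    ((KernelFork.isLimitMapConeEquiv _ ShortComplex.π₁).symm (kernelIsKernel φ.τ₁))
    ((KernelFork.isLimitMapConeEquiv _ ShortComplex.π₂).symm (kernelIsKernel φ.τ₂))
    ((KernelFork.isLimitMapConeEquiv _ ShortComplex.π₃).symm (kernelIsKernel φ.τ₃))
  h₃ := ShortComplex.isColimitOfIsColimitπ _
    ((CokernelCofork.isColimitMapCoconeEquiv _ ShortComplex.π₁).symm (cokernelIsCokernel φ.τ₁))
    ((CokernelCofork.isColimitMapCoconeEquiv _ ShortComplex.π₂).symm (cokernelIsCokernel φ.τ₂))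
    ((CokernelCofork.isColimitMapCoconeEquiv _ ShortComplex.π₃).symm (cokernelIsCokernel φ.τ₃))
  L₁_exact := hS.exact
  epi_L₁_g := hS.epi_g
  L₂_exact := hT.exact
  mono_L₂_f := hT.mono_f

lemma snakeInput_shortExact_δ (I : ShortComplex.SnakeInput A) (hg : I.L₀.g = 0)
    [Epi I.L₂.g] :
    ∃ w, (ShortComplex.mk I.δ (kernel.lift I.L₃.g I.L₃.f I.L₃.zero) w).ShortExact := by
  have hδ : Mono I.δ := I.L₁'_exact.mono_g hg
  have hp : Epi (kernel.lift I.L₃.g I.L₃.f I.L₃.zero) := I.L₃_exact.epi_kernelLift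
  have hw : I.δ ≫ kernel.lift I.L₃.g I.L₃.f I.L₃.zero = 0 := by
    rw [← cancel_mono (kernel.ι _), Category.assoc, kernel.lift_ι, zero_comp, I.δ_L₃_f]
  refine ⟨hw, { exact := ?_, mono_f := hδ, epi_g := hp }⟩
  let χ : ShortComplex.mk I.δ (kernel.lift I.L₃.g I.L₃.f I.L₃.zero) hw ⟶ I.L₂' :=
    { τ₁ := 𝟙 _, τ₂ := 𝟙 _, τ₃ := kernel.ι I.L₃.g
      comm₁₂ := (Category.id_comp _).trans (Category.comp_id _).symm
      comm₂₃ := (Category.id_comp _).trans (kernel.lift_ι _ _ _).symm }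
  have : Epi χ.τ₁ := inferInstanceAs (Epi (𝟙 I.L₀.X₃))
  have : IsIso χ.τ₂ := inferInstanceAs (IsIso (𝟙 I.L₃.X₁))
  have : Mono χ.τ₃ := inferInstanceAs (Mono (kernel.ι I.L₃.g))
  exact (ShortComplex.exact_iff_of_epi_of_isIso_of_mono χ).2 I.L₂'_exact

/-- As the kernel of `φ.τ₂` is zero, the snake sequence is a four-term exact sequence; it is cut at
the image `X` into two short exact sequences. -/
lemma ShortComplex.exists_snake {S T : ShortComplex A} (φ : S ⟶ T) (hS : S.ShortExact)
    (hT : T.ShortExact) [Mono φ.τ₂] :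
    ∃ (δ : kernel φ.τ₃ ⟶ cokernel φ.τ₁) (X : A) (p : cokernel φ.τ₁ ⟶ X)
      (i : X ⟶ cokernel φ.τ₂) (w : δ ≫ p = 0)
      (w' : i ≫ cokernel.map φ.τ₂ φ.τ₃ S.g T.g φ.comm₂₃ = 0),
      p ≫ i = cokernel.map φ.τ₁ φ.τ₂ S.f T.f φ.comm₁₂ ∧
      (ShortComplex.mk δ p w).ShortExact ∧ (ShortComplex.mk i _ w').ShortExact := by
  let I := snakeInputOfHom φ hS hT
  have hg : I.L₀.g = 0 := (isZero_kernel_of_mono φ.τ₂).eq_of_src _ _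
  have hT' : Epi I.L₂.g := hT.epi_g
  obtain ⟨w, hw⟩ := snakeInput_shortExact_δ I hg
  have m : ∀ {X Y : A} (f : X ⟶ Y), Mono (kernel.ι f) := fun f => inferInstance
  exact ⟨I.δ, kernel I.L₃.g, kernel.lift I.L₃.g I.L₃.f I.L₃.zero, kernel.ι I.L₃.g, w,
    kernel.condition _, kernel.lift_ι _ _ _, hw,
    { exact := ShortComplex.exact_kernel _
      mono_f := m _
      epi_g := I.epi_L₃_g }⟩

end Snake

/-! ### Kernel and cokernel of the map from a module to its shift. -/

section Shift

variable {k : Type u} [CommRing k] {D : Type} [Category.{u} D] {F : D ⥤ D} (η : 𝟭 D ⟶ F)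

lemma toShift_naturality {V W : D ⥤ ModuleCat.{u} k} (φ : V ⟶ W) :
    toShift η V ≫ Functor.whiskerLeft F φ = φ ≫ toShift η W := by
  ext n v
  exact (ConcreteCategory.congr_hom (φ.naturality (η.app n)) v)

/-- The morphism of short complexes from `S` to its shift. -/
def toShiftHom (S : ShortComplex (D ⥤ ModuleCat.{u} k)) :
    S ⟶ S.map ((Functor.whiskeringLeft D D (ModuleCat.{u} k)).obj F) where
  τ₁ := toShift η S.X₁
  τ₂ := toShift η S.X₂
  τ₃ := toShift η S.X₃
  comm₁₂ := toShift_naturality η S.f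
  comm₂₃ := toShift_naturality η S.g

/-- The functoriality of the cokernel of `V ⟶ V ∘ F`. -/
abbrev shiftCokernelMap {V W : D ⥤ ModuleCat.{u} k} (φ : V ⟶ W) :
    cokernel (toShift η V) ⟶ cokernel (toShift η W) :=
  cokernel.map _ _ φ (Functor.whiskerLeft F φ) (toShift_naturality η φ)

lemma exists_shift_snake {S : ShortComplex (D ⥤ ModuleCat.{u} k)} (hS : S.ShortExact)
    [Mono (toShift η S.X₂)] :
    ∃ (δ : kernel (toShift η S.X₃) ⟶ cokernel (toShift η S.X₁)) (X : D ⥤ ModuleCat.{u} k)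
      (p : cokernel (toShift η S.X₁) ⟶ X) (i : X ⟶ cokernel (toShift η S.X₂)) (w : δ ≫ p = 0)
      (w' : i ≫ shiftCokernelMap η S.g = 0), p ≫ i = shiftCokernelMap η S.f ∧
      (ShortComplex.mk δ p w).ShortExact ∧ (ShortComplex.mk i _ w').ShortExact :=
  have : Mono (toShiftHom η S).τ₂ := inferInstanceAs (Mono (toShift η S.X₂))
  ShortComplex.exists_snake (toShiftHom η S) hS
    (hS.map_of_exact ((Functor.whiskeringLeft D D (ModuleCat.{u} k)).obj F))

variable [RankedCategory D]

variable (k) in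
/-- A shift of a ranked category, along which every free module embeds into its shift with
projective cokernel, and whose decomposable elements can be detected before shifting. -/
structure IsDerivingShift : Prop where
  mono : ∀ x : D, Mono (toShift η (freeModule k x))
  projective : ∀ x : D, Projective (cokernel (toShift η (freeModule k x)))
  decomposables_eq : ∀ (V : D ⥤ ModuleCat.{u} k) (n : D), decomposables V (F.obj n) =
    decomposables (F ⋙ V) n ⊔ LinearMap.range (V.map (η.app n)).hom

variable {η} (hη : IsDerivingShift k η)
include hη

/-- The comparison between `H_0(V)_{F n}` and `H_0` of the cokernel of `V ⟶ V ∘ F` at `n`. -/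
def zerothHomologyShift (V : D ⥤ ModuleCat.{u} k) (n : D) :
    (zerothHomologyAt k (F.obj n)).obj V ⟶ (zerothHomologyAt k n).obj (cokernel (toShift η V)) :=
  ModuleCat.ofHom <| (decomposables V (F.obj n)).mapQ (decomposables (cokernel (toShift η V)) n)
    ((cokernel.π (toShift η V)).app n).hom (by
      rw [hη.decomposables_eq]
      refine sup_le (decomposables_le_comap_app _ n) ?_
      rintro _ ⟨v, rfl⟩
      have : (cokernel.π (toShift η V)).app n ((toShift η V).app n v) = 0 := by
        rw [← ConcreteCategory.comp_apply, ← NatTrans.comp_app, cokernel.condition]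
        rfl
      refine Submodule.mem_comap.2 ?_
      exact this.symm ▸ zero_mem (decomposables (cokernel (toShift η V)) n))

lemma zerothHomologyShift_naturality {V W : D ⥤ ModuleCat.{u} k} (φ : V ⟶ W) (n : D) :
    zerothHomologyShift hη V n ≫ (zerothHomologyAt k n).map (shiftCokernelMap η φ) =
      (zerothHomologyAt k (F.obj n)).map φ ≫ zerothHomologyShift hη W n := by
  apply ModuleCat.hom_ext
  apply Submodule.linearMap_qext
  ext v
  have : (shiftCokernelMap η φ).app n ((cokernel.π (toShift η V)).app n v) =
      (cokernel.π (toShift η W)).app n (φ.app (F.obj n) v) := by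
    rw [← ConcreteCategory.comp_apply, ← NatTrans.comp_app, cokernel.π_desc]
    rfl
  exact congrArg (decomposables (cokernel (toShift η W)) n).mkQ this

/-- An element that becomes decomposable in the cokernel is a decomposable element of `F ⋙ V` plus
one in the image of η. Both are decomposable in `V` at `F.obj n`, which gives injectivity. -/
instance isIso_zerothHomologyShift (V : D ⥤ ModuleCat.{u} k) (n : D) :
    IsIso (zerothHomologyShift hη V n) := by
  rw [ConcreteCategory.isIso_iff_bijective]
  constructor
  · rw [injective_iff_map_eq_zero]
    intro x hx
    obtain ⟨x : (F ⋙ V).obj n, rfl⟩ := Submodule.mkQ_surjective _ x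
    have h1 : (cokernel.π (toShift η V)).app n x ∈ decomposables (cokernel (toShift η V)) n :=
      (Submodule.Quotient.mk_eq_zero _).1 hx
    rw [decomposables_eq_map_of_epi (cokernel.π (toShift η V)) n] at h1
    obtain ⟨y, hy, hyx⟩ := h1
    obtain ⟨z, hz⟩ := exists_app_eq_of_exact (ShortComplex.exact_cokernel (toShift η V)) n
      (v := x - y) (by
        rw [map_sub, sub_eq_zero]
        exact hyx.symm)
    refine (Submodule.Quotient.mk_eq_zero _).2 ?_
    rw [hη.decomposables_eq, ← sub_add_cancel x y]
    refine add_mem ?_ (Submodule.mem_sup_left hy)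
    exact Submodule.mem_sup_right ⟨z, hz⟩
  · intro y
    obtain ⟨y, rfl⟩ := Submodule.mkQ_surjective _ y
    obtain ⟨x, rfl⟩ := app_surjective_of_epi (cokernel.π (toShift η V)) n y
    exact ⟨(decomposables V (F.obj n)).mkQ x, rfl⟩

lemma mono_zerothHomologyAt_shiftCokernelMap_iff {V W : D ⥤ ModuleCat.{u} k} (φ : V ⟶ W)
    (n : D) : Mono ((zerothHomologyAt k n).map (shiftCokernelMap η φ)) ↔
      Mono ((zerothHomologyAt k (F.obj n)).map φ) := by
  have e := zerothHomologyShift_naturality hη φ n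
  constructor
  · intro h
    have : Mono ((zerothHomologyAt k (F.obj n)).map φ ≫ zerothHomologyShift hη W n) := by
      rw [← e]
      exact mono_comp _ _
    exact mono_of_mono _ (zerothHomologyShift hη W n)
  · intro h
    have : (zerothHomologyAt k n).map (shiftCokernelMap η φ) = inv (zerothHomologyShift hη V n) ≫
      (zerothHomologyAt k (F.obj n)).map φ ≫ zerothHomologyShift hη W n := by
      rw [← e, IsIso.inv_hom_id_assoc]
    rw [this]
    exact mono_comp _ _

lemma homologyVanishes_zero_shiftCokernel_iff (V : D ⥤ ModuleCat.{u} k) (n : D) :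
    HomologyVanishes 0 (cokernel (toShift η V)) n ↔ HomologyVanishes 0 V (F.obj n) := by
  unfold HomologyVanishes
  rw [Functor.isZero_leftDerived_zero_iff, Functor.isZero_leftDerived_zero_iff]
  exact (asIso (zerothHomologyShift hη V n)).symm.isZero_iff

end Shift

/-! ### Shifts of coproducts. -/

section ShiftCoproduct

variable {k : Type u} [CommRing k] {D : Type} [Category.{u} D] {F : D ⥤ D} (η : 𝟭 D ⟶ F)
  {I : Type u} (f : I → D ⥤ ModuleCat.{u} k)

/-- Precomposition with `F` preserves coproducts. -/
def isColimitShiftCofan : IsColimit (Cofan.mk (F ⋙ ∐ f) fun i =>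
    Functor.whiskerLeft F (Sigma.ι f i)) :=
  isColimitCofanMkObjOfIsColimit ((Functor.whiskeringLeft D D (ModuleCat.{u} k)).obj F) f _
    (coproductIsCoproduct f)

lemma shift_coproduct_hom_ext {V : D ⥤ ModuleCat.{u} k} {a b : F ⋙ ∐ f ⟶ V}
    (h : ∀ i, Functor.whiskerLeft F (Sigma.ι f i) ≫ a = Functor.whiskerLeft F (Sigma.ι f i) ≫ b) :
    a = b :=
  Cofan.IsColimit.hom_ext (isColimitShiftCofan f) _ _ h

/-- Followed by the comparison with the coproduct of the shifts, the map is a coproduct of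
monomorphisms, and these are monomorphisms for modules. -/
lemma mono_toShift_coproduct [∀ i, Mono (toShift η (f i))] : Mono (toShift η (∐ f)) := by
  have e : toShift η (∐ f) ≫ (isColimitShiftCofan f).desc
      (Cofan.mk (∐ fun i => F ⋙ f i) fun i => Sigma.ι (fun i => F ⋙ f i) i) =
        Limits.Sigma.map fun i => toShift η (f i) := by
    refine Sigma.hom_ext _ _ fun i => ?_
    rw [Sigma.ι_map, ← Category.assoc, ← toShift_naturality, Category.assoc]
    exact congrArg (toShift η (f i) ≫ ·) ((isColimitShiftCofan f).fac _ ⟨i⟩)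
  have : Mono (toShift η (∐ f) ≫ (isColimitShiftCofan f).desc
      (Cofan.mk (∐ fun i => F ⋙ f i) fun i => Sigma.ι (fun i => F ⋙ f i) i)) := by
    rw [e]
    infer_instance
  exact mono_of_mono _ ((isColimitShiftCofan f).desc
      (Cofan.mk (∐ fun i => F ⋙ f i) fun i => Sigma.ι (fun i => F ⋙ f i) i))

lemma projective_shiftCokernel_coproduct [∀ i, Projective (cokernel (toShift η (f i)))] :
    Projective (cokernel (toShift η (∐ f))) where
  factors {E X} φ e _ := by
    let θ (i : I) : cokernel (toShift η (f i)) ⟶ E :=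
      Projective.factorThru (shiftCokernelMap η (Sigma.ι f i) ≫ φ) e
    have hθ (i : I) : θ i ≫ e = shiftCokernelMap η (Sigma.ι f i) ≫ φ :=
      Projective.factorThru_comp _ _
    let c : F ⋙ ∐ f ⟶ E := (isColimitShiftCofan f).desc
      (Cofan.mk E fun i => cokernel.π (toShift η (f i)) ≫ θ i)
    have hc (i : I) : Functor.whiskerLeft F (Sigma.ι f i) ≫ c =
      cokernel.π (toShift η (f i)) ≫ θ i := (isColimitShiftCofan f).fac _ ⟨i⟩
    refine ⟨cokernel.desc _ c ?_, ?_⟩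
    · refine Sigma.hom_ext _ _ fun i => ?_
      rw [← Category.assoc, ← toShift_naturality, Category.assoc, hc, cokernel.condition_assoc,
        zero_comp, comp_zero]
    · rw [← cancel_epi (cokernel.π _), cokernel.π_desc_assoc]
      refine shift_coproduct_hom_ext f fun i => ?_
      rw [← Category.assoc, hc, Category.assoc, hθ, cokernel.π_desc_assoc, Category.assoc]

end ShiftCoproduct

/-! ### The long exact sequence of a shift. -/

section LongExactSequenceOfShift

variable {k : Type u} [CommRing k] {D : Type} [Category.{u} D]

/-- Every module is a quotient of a coproduct of free modules. -/
lemma exists_free_cover (V : D ⥤ ModuleCat.{u} k) :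
    ∃ (I : Type u) (x : I → D) (S : ShortComplex (D ⥤ ModuleCat.{u} k)),
      S.ShortExact ∧ S.X₂ = (∐ fun i => freeModule k (x i)) ∧ S.X₃ = V := by
  have hp := (enoughProjectives_modules.presentation V).some.epi
  refine ⟨Σ x : D, V.obj x, Sigma.fst, ShortComplex.mk _ _ (kernel.condition
    (Sigma.desc fun a : Σ x : D, V.obj x => freeModuleDesc a.2)), ?_, rfl, rfl⟩
  have : Epi (Sigma.desc fun a : Σ x : D, V.obj x => freeModuleDesc a.2) := by
    rw [NatTrans.epi_iff_epi_app]
    intro x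
    rw [ModuleCat.epi_iff_surjective]
    intro v
    refine ⟨(Sigma.ι (fun a : Σ x : D, V.obj x => freeModule k a.1) ⟨x, v⟩).app x
      (freeModuleMk (𝟙 x)), ?_⟩
    rw [← ConcreteCategory.comp_apply, ← NatTrans.comp_app, Sigma.ι_desc,
      freeModuleDesc_app_id]
  exact { exact := ShortComplex.exact_kernel _ }

lemma shortExact_shiftCokernel {F : D ⥤ D} (η : 𝟭 D ⟶ F)
    {S : ShortComplex (D ⥤ ModuleCat.{u} k)} (hS : S.ShortExact)
    [Mono (toShift η S.X₂)] [Mono (toShift η S.X₃)] :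
    ∃ w, (ShortComplex.mk (shiftCokernelMap η S.f) (shiftCokernelMap η S.g) w).ShortExact := by
  obtain ⟨δ, X, p, i, w, w', hpi, h, h'⟩ := exists_shift_snake η hS
  have hδ : δ = 0 := (isZero_kernel_of_mono (toShift η S.X₃)).eq_of_src _ _
  have : Mono p := h.exact.mono_g hδ
  have : Epi p := h.epi_g
  have : IsIso p := isIso_of_mono_of_epi p
  have hw : shiftCokernelMap η S.f ≫ shiftCokernelMap η S.g = 0 := by
    rw [← hpi, Category.assoc, w', comp_zero]
  have e : ShortComplex.mk (shiftCokernelMap η S.f) (shiftCokernelMap η S.g) hw ≅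
      ShortComplex.mk i (shiftCokernelMap η S.g) w' :=
    ShortComplex.isoMk (asIso p) (Iso.refl _) (Iso.refl _) ?_ ?_
  · exact ⟨hw, ShortComplex.shortExact_of_iso e.symm h'⟩
  · exact hpi.trans (Category.comp_id _).symm
  · exact (Category.id_comp _).trans (Category.comp_id _).symm

variable {F : D ⥤ D} {η : 𝟭 D ⟶ F} (hη : IsDerivingShift k η)
include hη

/-- Covers by projectives that behave well under the shift. -/
lemma IsDerivingShift.exists_cover (V : D ⥤ ModuleCat.{u} k) :
    ∃ (S : ShortComplex (D ⥤ ModuleCat.{u} k)), S.ShortExact ∧ S.X₃ = V ∧ Projective S.X₂ ∧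
      Mono (toShift η S.X₂) ∧ Mono (toShift η S.X₁) ∧ Projective (cokernel (toShift η S.X₂)) := by
  obtain ⟨I, x, S, hS, h₂, h₃⟩ := exists_free_cover V
  have := hη.mono
  have := hη.projective
  have m : Mono (toShift η S.X₂) := h₂ ▸ mono_toShift_coproduct η _
  refine ⟨S, hS, h₃, h₂ ▸ inferInstance, m, ?_, h₂ ▸ projective_shiftCokernel_coproduct η _⟩
  have := hS.mono_f
  have : Mono (toShift η S.X₁ ≫ Functor.whiskerLeft F S.f) := by
    rw [toShift_naturality]
    exact mono_comp _ _
  exact mono_of_mono _ (Functor.whiskerLeft F S.f)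

variable [RankedCategory D]

/-- When the kernel term is zero, the cokernel functor carries a free cover to a projective cover,
and H_0 agrees on both sides. The syzygy again embeds into its shift, so dimension shifting
continues. -/
lemma IsDerivingShift.homologyVanishes_succ_iff_of_mono (s : ℕ) (W : D ⥤ ModuleCat.{u} k)
    [hW : Mono (toShift η W)] (n : D) :
    HomologyVanishes (s + 1) (cokernel (toShift η W)) n ↔
      HomologyVanishes (s + 1) W (F.obj n) := by
  obtain ⟨S, hS, rfl, h₂, m₂, m₁, hD⟩ := hη.exists_cover W
  obtain ⟨w, h⟩ := shortExact_shiftCokernel η hS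
  have : Projective (ShortComplex.mk _ _ w).X₂ := hD
  induction s generalizing S with
  | zero =>
    exact (homologyVanishes_one_iff h n).trans
      ((mono_zerothHomologyAt_shiftCokernelMap_iff hη S.f n).trans
        (homologyVanishes_one_iff hS (F.obj n)).symm)
  | succ s ih =>
    refine (homologyVanishes_add_two_iff h n s).trans (Iff.trans ?_
        (homologyVanishes_add_two_iff hS (F.obj n) s).symm)
    obtain ⟨S', hS', e, h₂', m₂', m₁', hD'⟩ := hη.exists_cover S.X₁
    have : Mono (toShift η S'.X₃) := e ▸ m₁
    obtain ⟨w', h'⟩ := shortExact_shiftCokernel η hS'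
    have := ih S' hS' h₂' m₂' m₁' hD' w' h' hD'
    rwa [e] at this

lemma IsDerivingShift.homologyVanishes_kernel (s : ℕ) (V : D ⥤ ModuleCat.{u} k) (n : D)
    (h₁ : HomologyVanishes (s + 2) (cokernel (toShift η V)) n)
    (h₂ : HomologyVanishes (s + 1) V (F.obj n)) :
    HomologyVanishes s (kernel (toShift η V)) n := by
  obtain ⟨S, hS, rfl, hP, m₂, m₁, hD⟩ := hη.exists_cover V
  obtain ⟨δ, X, p, i, w, w', hpi, h, h'⟩ := exists_shift_snake η hS
  have : Projective (ShortComplex.mk i _ w').X₂ := hD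
  -- `X` is a syzygy of the cokernel for V, because the middle term of `h'` is projective.
  have hX : HomologyVanishes (s + 1) X n := (homologyVanishes_add_two_iff h' n s).1 h₁
  obtain _ | s := s
  -- On H_0 the map `δ` is injective, yet it is killed by `p ≫ i`, which is injective on H_0 by
  -- `h₂`. So H_0 of the kernel is zero.
  · have mδ : Mono ((zerothHomologyAt k n).map δ) := mono_of_homologyVanishes_one h n hX
    have mf := (mono_zerothHomologyAt_shiftCokernelMap_iff hη S.f n).2
      ((homologyVanishes_one_iff hS (F.obj n)).1 h₂)
    have e : (zerothHomologyAt k n).map δ = 0 := by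
      rw [← cancel_mono ((zerothHomologyAt k n).map (shiftCokernelMap η S.f)), ← Functor.map_comp,
        ← hpi, reassoc_of% w, zero_comp, zero_comp, Functor.map_zero]
    exact (homologyVanishes_zero_iff_isZero _ n).2 (IsZero.of_mono_eq_zero _ e)
  · exact homologyVanishes_left h n hX ((hη.homologyVanishes_succ_iff_of_mono s S.X₁ n).2
      ((homologyVanishes_add_two_iff hS (F.obj n) s).1 h₂))

lemma IsDerivingShift.homologyVanishes_succ (s : ℕ) (V : D ⥤ ModuleCat.{u} k) (n : D)
    (h₁ : HomologyVanishes s (kernel (toShift η V)) n)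
    (h₂ : HomologyVanishes (s + 1) (cokernel (toShift η V)) n) :
    HomologyVanishes (s + 1) V (F.obj n) := by
  obtain ⟨S, hS, rfl, hP, m₂, m₁, hD⟩ := hη.exists_cover V
  obtain ⟨δ, X, p, i, w, w', hpi, h, h'⟩ := exists_shift_snake η hS
  have : Projective (ShortComplex.mk i _ w').X₂ := hD
  obtain _ | s := s
  · have mi : Mono ((zerothHomologyAt k n).map i) := (homologyVanishes_one_iff h' n).1 h₂
    have mp : Mono ((zerothHomologyAt k n).map p) :=
      mono_zerothHomologyAt_of_homologyVanishes_zero h n h₁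
    refine (homologyVanishes_one_iff hS (F.obj n)).2
      ((mono_zerothHomologyAt_shiftCokernelMap_iff hη S.f n).1 ?_)
    rw [← hpi, Functor.map_comp]
    exact mono_comp _ _
  · exact (homologyVanishes_add_two_iff hS (F.obj n) s).2
      ((hη.homologyVanishes_succ_iff_of_mono s S.X₁ n).1
        (homologyVanishes_middle h n h₁ ((homologyVanishes_add_two_iff h' n s).1 h₂)))

/-- This is the end of the long exact sequence, where H_1(V) at `F.obj n` surjects onto H_1 of the
cokernel at `n`. It keeps hd_1 bounded in the inductions on generation degree. -/
lemma IsDerivingShift.homologyVanishes_one_shiftCokernel (V : D ⥤ ModuleCat.{u} k) (n : D)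
    (h₁ : HomologyVanishes 1 V (F.obj n)) :
    HomologyVanishes 1 (cokernel (toShift η V)) n := by
  obtain ⟨S, hS, rfl, hP, m₂, m₁, hD⟩ := hη.exists_cover V
  obtain ⟨δ, X, p, i, w, w', hpi, h, h'⟩ := exists_shift_snake η hS
  have : Projective (ShortComplex.mk i _ w').X₂ := hD
  have : Epi p := h.epi_g
  refine (homologyVanishes_one_iff h' n).2 ?_
  have mf := (mono_zerothHomologyAt_shiftCokernelMap_iff hη S.f n).2
    ((homologyVanishes_one_iff hS (F.obj n)).1 h₁)
  rw [← hpi, Functor.map_comp] at mf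
  rw [ModuleCat.mono_iff_injective, injective_iff_map_eq_zero] at mf ⊢
  intro x hx
  obtain ⟨y, rfl⟩ := (zerothHomologyAt k n).map_surjective_of_epi p x
  rw [mf y hx, map_zero]

end LongExactSequenceOfShift

/-! ### Bases of free modules and shifts of a product in one coordinate. -/

section FreeModule

variable {k : Type u} [CommRing k] {D : Type} [Category.{u} D]

lemma freeModule_map_mk {x y z : D} (a : x ⟶ y) (g : y ⟶ z) :
    (freeModule k x).map g (freeModuleMk a) = freeModuleMk (a ≫ g) :=
  ModuleCat.free_map_apply _ _

lemma freeModule_obj_hom_ext {x y : D} {M : ModuleCat.{u} k}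
    {φ χ : (freeModule k x).obj y ⟶ M}
    (h : ∀ a : x ⟶ y, φ (freeModuleMk a) = χ (freeModuleMk a)) : φ = χ :=
  ModuleCat.free_hom_ext h

/-- The linear map out of `M(x)_y` with given values on the basis. -/
def freeModuleObjDesc {x y : D} {M : ModuleCat.{u} k} (v : (x ⟶ y) → M) :
    (freeModule k x).obj y ⟶ M :=
  ModuleCat.freeDesc (↾ v)

@[simp]
lemma freeModuleObjDesc_mk {x y : D} {M : ModuleCat.{u} k} (v : (x ⟶ y) → M) (a : x ⟶ y) :
    freeModuleObjDesc v (freeModuleMk a) = v a :=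
  ModuleCat.freeDesc_apply _ _

lemma span_freeModuleMk (x y : D) :
    Submodule.span k (Set.range (freeModuleMk (k := k) (x := x) (y := y))) = ⊤ := by
  let Q := Submodule.span k (Set.range (freeModuleMk (k := k) (x := x) (y := y)))
  have : ModuleCat.ofHom Q.mkQ = 0 := by
    apply freeModule_obj_hom_ext
    intro a
    exact (Submodule.Quotient.mk_eq_zero _).2 (Submodule.subset_span ⟨a, rfl⟩)
  have h : Q.mkQ = 0 := congrArg ModuleCat.Hom.hom this
  exact (Submodule.ker_mkQ Q).symm.trans (h ▸ LinearMap.ker_zero)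

lemma naturality_mk {F : D ⥤ D} {V : D ⥤ ModuleCat.{u} k} {x : D} (φ : F ⋙ freeModule k x ⟶ V)
    {y z : D} (a : x ⟶ F.obj y) (g : y ⟶ z) :
    V.map g (φ.app y (freeModuleMk a)) = φ.app z (freeModuleMk (a ≫ F.map g)) := by
  rw [← freeModule_map_mk]
  exact (ConcreteCategory.congr_hom (φ.naturality g) _).symm

end FreeModule

section Pi

variable {ι : Type} [DecidableEq ι] {C : ι → Type} [∀ j, Category.{u} (C j)]

/-- A morphism in a product category, given by its component at `i` and the other ones. -/
def piHom {x y : ∀ j, C j} (i : ι) (a : x i ⟶ y i) (b : ∀ j, j ≠ i → (x j ⟶ y j)) : x ⟶ y :=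
  fun j => if h : j = i then cast (by rw [h]) a else b j h

@[simp]
lemma piHom_self {x y : ∀ j, C j} (i : ι) (a : x i ⟶ y i) (b : ∀ j, j ≠ i → (x j ⟶ y j)) :
    piHom i a b i = a := by
  simp [piHom]

lemma piHom_of_ne {x y : ∀ j, C j} {i : ι} (a : x i ⟶ y i) (b : ∀ j, j ≠ i → (x j ⟶ y j)) {j : ι}
    (h : j ≠ i) : piHom i a b j = b j h := by
  simp [piHom, h]

lemma piHom_ext {x y : ∀ j, C j} (i : ι) {f g : x ⟶ y} (h : f i = g i)
    (h' : ∀ j, j ≠ i → f j = g j) : f = g := by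
  funext j
  by_cases hj : j = i
  · subst hj
    exact h
  · exact h' j hj

/-- The natural transformation `Id ⟶ ∏ G j` with components `η j`. -/
def piShift {G : ∀ j, C j ⥤ C j} (η : ∀ j, 𝟭 (C j) ⟶ G j) :
    𝟭 (∀ j, C j) ⟶ Functor.pi G where
  app x j := (η j).app (x j)
  naturality x y f := by
    funext j
    exact (η j).naturality (f j)

/-- A functor `C i ⥤ ∏ C j` which is the identity in the coordinate `i` and constant with value
`x j` in the other coordinates, up to isomorphism. -/
structure CoordinateInclusion (i : ι) (x : ∀ j, C j) where
  /-- the functor -/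
  functor : C i ⥤ ∀ j, C j
  /-- the component at `i` -/
  toSelf : ∀ a, functor.obj a i ⟶ a
  /-- the inverse of `toSelf` -/
  ofSelf : ∀ a, a ⟶ functor.obj a i
  /-- the other components -/
  toConst : ∀ a j, j ≠ i → (functor.obj a j ⟶ x j)
  /-- the inverse of `toConst` -/
  ofConst : ∀ a j, j ≠ i → (x j ⟶ functor.obj a j)
  ofSelf_toSelf : ∀ a, ofSelf a ≫ toSelf a = 𝟙 a
  ofConst_toConst : ∀ a j h, ofConst a j h ≫ toConst a j h = 𝟙 (x j)
  map_toSelf : ∀ {a b} (t : a ⟶ b), (functor.map t : ∀ _, _) i ≫ toSelf b = toSelf a ≫ t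
  ofSelf_map : ∀ {a b} (t : a ⟶ b), ofSelf a ≫ (functor.map t : ∀ _, _) i = t ≫ ofSelf b
  map_toConst : ∀ {a b} (t : a ⟶ b) j h,
    (functor.map t : ∀ _, _) j ≫ toConst b j h = toConst a j h
  ofConst_map : ∀ {a b} (t : a ⟶ b) j h,
    ofConst a j h ≫ (functor.map t : ∀ _, _) j = ofConst b j h

/-- A coordinate inclusion assembled from isomorphisms of functors. -/
def CoordinateInclusion.ofIso (i : ι) (x : ∀ j, C j) (A : ∀ j, C i ⥤ C j) (α : A i ≅ 𝟭 (C i))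
    (β : ∀ j, j ≠ i → (A j ≅ (Functor.const (C i)).obj (x j))) : CoordinateInclusion i x where
  functor := Functor.pi' A
  toSelf a := α.hom.app a
  ofSelf a := α.inv.app a
  toConst a j h := (β j h).hom.app a
  ofConst a j h := (β j h).inv.app a
  ofSelf_toSelf a := α.inv_hom_id_app a
  ofConst_toConst a j h := (β j h).inv_hom_id_app a
  map_toSelf t := α.hom.naturality t
  ofSelf_map t := (α.inv.naturality t).symm
  map_toConst t j h := ((β j h).hom.naturality t).trans (Category.comp_id _)
  ofConst_map t j h := ((β j h).inv.naturality t).symm.trans (Category.id_comp _)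

instance (i : ι) (x : ∀ j, C j) : Nonempty (CoordinateInclusion i x) := by
  let A : ∀ j, C i ⥤ C j := Function.update (fun j => (Functor.const (C i)).obj (x j)) i (𝟭 (C i))
  exact ⟨.ofIso i x A (eqToIso (Function.update_self _ _ _))
    fun j h => eqToIso (Function.update_of_ne h _ _)⟩

variable {i : ι} {x : ∀ j, C j} (A : CoordinateInclusion i x)
variable {k : Type u} [CommRing k] {G : ∀ j, C j ⥤ C j} (η : ∀ j, 𝟭 (C j) ⟶ G j)

/-- Extending a morphism `x i ⟶ G i a` to a morphism `x ⟶ (∏ G j)(a, x)`. -/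
def CoordinateInclusion.extend {a : C i} (g : x i ⟶ (G i).obj a) :
    x ⟶ (Functor.pi G).obj (A.functor.obj a) :=
  piHom i (g ≫ (G i).map (A.ofSelf a))
    fun j h => A.ofConst a j h ≫ (η j).app (A.functor.obj a j)

lemma comp_app_comp_map {E : Type} [Category.{u} E] {G : E ⥤ E} (η : 𝟭 E ⟶ G) {x y z : E}
    (f : x ⟶ y) (g : y ⟶ z) : (f ≫ η.app y) ≫ G.map g = (f ≫ g) ≫ η.app z := by
  have := η.naturality g
  simp only [Functor.id_map] at this
  simp [← this]

lemma comp_map_comp_map_of_retract {E : Type} [Category.{u} E] {G : E ⥤ E} {x y z : E}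
    (f : x ⟶ G.obj y) {o : y ⟶ z} {r : z ⟶ y} (h : o ≫ r = 𝟙 y) :
    (f ≫ G.map o) ≫ G.map r = f := by
  rw [Category.assoc, ← G.map_comp, h, G.map_id, Category.comp_id]

lemma CoordinateInclusion.extend_comp_map {a b : C i} (g : x i ⟶ (G i).obj a) (t : a ⟶ b) :
    A.extend η g ≫ (Functor.pi G).map (A.functor.map t) = A.extend η (g ≫ (G i).map t) := by
  refine piHom_ext i ?_ fun j h => ?_
  · simp only [Pi.comp_apply, CoordinateInclusion.extend, piHom_self]
    change (g ≫ (G i).map (A.ofSelf a)) ≫ (G i).map ((A.functor.map t : ∀ _, _) i) =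
      (g ≫ (G i).map t) ≫ (G i).map (A.ofSelf b)
    simp only [Category.assoc, ← Functor.map_comp, A.ofSelf_map]
  · simp only [Pi.comp_apply, CoordinateInclusion.extend, piHom_of_ne _ _ h]
    refine (comp_app_comp_map (η j) _ _).trans ?_
    rw [A.ofConst_map]
    rfl

variable {η} (hη : ∀ j, j ≠ i → IsIso (η j))

/-- The inverse of `η j` for `j ≠ i`. -/
def invShift (j : ι) (h : j ≠ i) (y : C j) : (G j).obj y ⟶ y :=
  have := hη j h
  (inv (η j)).app y

section

omit [DecidableEq ι]

lemma app_invShift (j : ι) (h : j ≠ i) (y : C j) : (η j).app y ≫ invShift hη j h y = 𝟙 y := by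
  have := hη j h
  simp [invShift]

lemma invShift_app (j : ι) (h : j ≠ i) (y : C j) :
    invShift hη j h y ≫ (η j).app y = 𝟙 ((G j).obj y) := by
  have := hη j h
  simp [invShift]

lemma map_invShift (j : ι) (h : j ≠ i) {y z : C j} (t : y ⟶ z) :
    (G j).map t ≫ invShift hη j h z = invShift hη j h y ≫ t :=
  have := hη j h
  (inv (η j)).naturality t

lemma comp_invShift_comp_app (j : ι) (h : j ≠ i) {y z : C j} (f : z ⟶ (G j).obj y) :
    (f ≫ invShift hη j h y) ≫ (η j).app y = f := by
  rw [Category.assoc, invShift_app, Category.comp_id]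

lemma comp_map_comp_invShift (j : ι) (h : j ≠ i) {w y z x : C j} (a : w ⟶ x)
    (f : x ⟶ (G j).obj y) (t : y ⟶ z) : a ≫ (f ≫ (G j).map t) ≫ invShift hη j h z =
      (a ≫ f ≫ invShift hη j h y) ≫ t := by
  simp only [Category.assoc, map_invShift]

end

/-- The part of a morphism `x ⟶ (∏ G j) l` away from the coordinate `i`. -/
def CoordinateInclusion.rest {l : ∀ j, C j} (f : x ⟶ (Functor.pi G).obj l) :
    A.functor.obj (l i) ⟶ l :=
  piHom i (A.toSelf (l i)) fun j h => A.toConst (l i) j h ≫ f j ≫ invShift hη j h (l j)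

lemma CoordinateInclusion.map_comp_rest {l l' : ∀ j, C j} (f : x ⟶ (Functor.pi G).obj l)
    (t : l ⟶ l') : A.functor.map (t i) ≫ A.rest hη (f ≫ (Functor.pi G).map t) =
      A.rest hη f ≫ t := by
  refine piHom_ext i ?_ fun j h => ?_
  · simp only [Pi.comp_apply, CoordinateInclusion.rest, piHom_self]
    exact A.map_toSelf (t i)
  · simp only [Pi.comp_apply, CoordinateInclusion.rest, piHom_of_ne _ _ h]
    rw [← Category.assoc, A.map_toConst]
    exact comp_map_comp_invShift hη j h _ (f j) (t j)

/-- Hence the shifted free module is generated by its restriction to the coordinate line through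
`x`, and morphisms out of it are determined there. -/
lemma CoordinateInclusion.extend_comp_map_rest {l : ∀ j, C j} (f : x ⟶ (Functor.pi G).obj l) :
    A.extend η (f i) ≫ (Functor.pi G).map (A.rest hη f) = f := by
  refine piHom_ext i ?_ fun j h => ?_
  · simp only [Pi.comp_apply, CoordinateInclusion.extend, piHom_self]
    change (f i ≫ (G i).map (A.ofSelf (l i))) ≫ (G i).map (A.rest hη f i) = f i
    rw [CoordinateInclusion.rest, piHom_self]
    exact comp_map_comp_map_of_retract (f i) (A.ofSelf_toSelf _)
  · simp only [Pi.comp_apply, CoordinateInclusion.extend, piHom_of_ne _ _ h]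
    refine (comp_app_comp_map (η j) _ _).trans ?_
    rw [CoordinateInclusion.rest, piHom_of_ne _ _ h, ← Category.assoc, A.ofConst_toConst,
      Category.id_comp]
    exact comp_invShift_comp_app hη j h (f j)

variable {V : (∀ j, C j) ⥤ ModuleCat.{u} k}

/-- Restriction to the coordinate `i` of a morphism defined on a shifted free module. -/
def CoordinateInclusion.restrictShift (φ : Functor.pi G ⋙ freeModule k x ⟶ V) :
    G i ⋙ freeModule k (x i) ⟶ A.functor ⋙ V where
  app a := freeModuleObjDesc fun g => φ.app (A.functor.obj a) (freeModuleMk (A.extend η g))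
  naturality a b t := by
    apply freeModule_obj_hom_ext
    intro g
    refine (congrArg (freeModuleObjDesc fun g => φ.app (A.functor.obj b)
      (freeModuleMk (A.extend η g))) (freeModule_map_mk g ((G i).map t))).trans ?_
    refine (freeModuleObjDesc_mk _ _).trans ?_
    refine Eq.trans ?_ (congrArg (V.map (A.functor.map t)) (freeModuleObjDesc_mk _ _)).symm
    rw [naturality_mk φ, A.extend_comp_map]

@[simp]
lemma CoordinateInclusion.restrictShift_mk (φ : Functor.pi G ⋙ freeModule k x ⟶ V) {a : C i}
    (g : x i ⟶ (G i).obj a) : (A.restrictShift (η := η) φ).app a (freeModuleMk g) =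
      φ.app (A.functor.obj a) (freeModuleMk (A.extend η g)) :=
  freeModuleObjDesc_mk _ _

/-- The inverse construction of `restrictShift`. -/
def CoordinateInclusion.extendShift (θ : G i ⋙ freeModule k (x i) ⟶ A.functor ⋙ V) :
    Functor.pi G ⋙ freeModule k x ⟶ V where
  app l := freeModuleObjDesc fun f =>
    V.map (A.rest hη f) (θ.app (l i) (freeModuleMk (f i)))
  naturality l l' t := by
    apply freeModule_obj_hom_ext
    intro f
    refine (congrArg (freeModuleObjDesc fun f => V.map (A.rest hη f)
      (θ.app (l' i) (freeModuleMk (f i)))) (freeModule_map_mk f ((Functor.pi G).map t))).trans ?_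
    refine (freeModuleObjDesc_mk _ _).trans ?_
    refine Eq.trans ?_ (congrArg (V.map t) (freeModuleObjDesc_mk _ _)).symm
    rw [← ConcreteCategory.comp_apply (V.map _), ← V.map_comp, ← A.map_comp_rest hη f t,
      V.map_comp, ConcreteCategory.comp_apply]
    congr 1
    exact (naturality_mk θ (f i) (t i)).symm

lemma CoordinateInclusion.extendShift_mk (θ : G i ⋙ freeModule k (x i) ⟶ A.functor ⋙ V)
    {l : ∀ j, C j} (f : x ⟶ (Functor.pi G).obj l) :
    (A.extendShift hη θ).app l (freeModuleMk f) =
      V.map (A.rest hη f) (θ.app (l i) (freeModuleMk (f i))) :=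
  freeModuleObjDesc_mk _ _

lemma CoordinateInclusion.extendShift_restrictShift (φ : Functor.pi G ⋙ freeModule k x ⟶ V) :
    A.extendShift hη (A.restrictShift (η := η) φ) = φ := by
  ext l : 2
  apply freeModule_obj_hom_ext
  intro f
  refine (A.extendShift_mk hη _ f).trans ?_
  refine (congrArg (V.map (A.rest hη f)) (A.restrictShift_mk φ (f i))).trans ?_
  rw [naturality_mk φ, A.extend_comp_map_rest]

lemma CoordinateInclusion.extendShift_comp (θ : G i ⋙ freeModule k (x i) ⟶ A.functor ⋙ V)
    {W : (∀ j, C j) ⥤ ModuleCat.{u} k} (e : V ⟶ W) :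
    A.extendShift hη (θ ≫ Functor.whiskerLeft A.functor e) = A.extendShift hη θ ≫ e := by
  ext l : 2
  apply freeModule_obj_hom_ext
  intro f
  refine (A.extendShift_mk hη _ f).trans (Eq.trans ?_
    (congrArg (e.app l) (A.extendShift_mk hη θ f)).symm)
  exact (ConcreteCategory.congr_hom (e.naturality (A.rest hη f)) _).symm

end Pi

/-! ### Shifts of free modules over the product: projective cokernels and injectivity. -/

section Projective

variable {ι : Type} [DecidableEq ι] {C : ι → Type} [∀ j, Category.{u} (C j)]
  {i : ι} {x : ∀ j, C j} (A : CoordinateInclusion i x)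
  {k : Type u} [CommRing k] {G : ∀ j, C j ⥤ C j} (η : ∀ j, 𝟭 (C j) ⟶ G j)

lemma toShift_mk {D : Type} [Category.{u} D] {F : D ⥤ D} (ε : 𝟭 D ⟶ F) {x y : D} (a : x ⟶ y) :
    (toShift ε (freeModule k x)).app y (freeModuleMk a) = freeModuleMk (a ≫ ε.app y) :=
  freeModule_map_mk a (ε.app y)

lemma CoordinateInclusion.extend_comp_app {a : C i} (g : x i ⟶ a) :
    A.extend η (g ≫ (η i).app a) =
      (piHom i (g ≫ A.ofSelf a) (A.ofConst a) : x ⟶ A.functor.obj a) ≫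
        (piShift η).app (A.functor.obj a) := by
  refine piHom_ext i ?_ fun j h => ?_
  · simp only [Pi.comp_apply, CoordinateInclusion.extend, piHom_self]
    exact comp_app_comp_map (η i) g (A.ofSelf a)
  · simp only [Pi.comp_apply, CoordinateInclusion.extend, piHom_of_ne _ _ h]
    rfl

lemma CoordinateInclusion.toShift_restrictShift {V : (∀ j, C j) ⥤ ModuleCat.{u} k}
    {φ : Functor.pi G ⋙ freeModule k x ⟶ V}
    (hφ : toShift (piShift η) (freeModule k x) ≫ φ = 0) :
    toShift (η i) (freeModule k (x i)) ≫ A.restrictShift (η := η) φ = 0 := by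
  ext a : 2
  apply freeModule_obj_hom_ext
  intro g
  refine (congrArg ((A.restrictShift (η := η) φ).app a) (toShift_mk (η i) g)).trans ?_
  refine (A.restrictShift_mk φ _).trans ?_
  rw [A.extend_comp_app, ← toShift_mk (k := k)]
  exact ConcreteCategory.congr_hom (congrArg (fun f => f.app (A.functor.obj a)) hφ) _

variable {η} (hη : ∀ j, j ≠ i → IsIso (η j))
include hη

lemma CoordinateInclusion.toShift_extendShift {V : (∀ j, C j) ⥤ ModuleCat.{u} k}
    {θ : G i ⋙ freeModule k (x i) ⟶ A.functor ⋙ V}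
    (hθ : toShift (η i) (freeModule k (x i)) ≫ θ = 0) :
    toShift (piShift η) (freeModule k x) ≫ A.extendShift hη θ = 0 := by
  ext l : 2
  apply freeModule_obj_hom_ext
  intro f
  refine (congrArg ((A.extendShift hη θ).app l) (toShift_mk (piShift η) f)).trans ?_
  refine (A.extendShift_mk hη θ _).trans ?_
  have : θ.app (l i) (freeModuleMk (f i ≫ (η i).app (l i))) = 0 := by
    rw [← toShift_mk (k := k)]
    exact ConcreteCategory.congr_hom (congrArg (fun f => f.app (l i)) hθ) _
  exact (congrArg _ this).trans (map_zero _)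

/-- A lifting problem is restricted to the coordinate line through `x`, solved there with the
one-variable projectivity, and extended back to the product. -/
lemma projective_cokernel_toShift_pi (x : ∀ j, C j)
    [Projective (cokernel (toShift (η i) (freeModule k (x i))))] :
    Projective (cokernel (toShift (piShift η) (freeModule k x))) where
  factors {E X} f e _ := by
    obtain ⟨A⟩ : Nonempty (CoordinateInclusion i x) := inferInstance
    have h₁ := A.toShift_restrictShift η (φ := cokernel.π _ ≫ f)
      (cokernel.condition_assoc _ _ |>.trans zero_comp)
    have : Epi (Functor.whiskerLeft A.functor e) :=
      inferInstanceAs (Epi (((Functor.whiskeringLeft _ _ (ModuleCat.{u} k)).obj A.functor).map e))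
    let θ := Projective.factorThru (cokernel.desc _ _ h₁) (Functor.whiskerLeft A.functor e)
    have hθ : θ ≫ Functor.whiskerLeft A.functor e = cokernel.desc _ _ h₁ :=
      Projective.factorThru_comp _ _
    have h₂ := A.toShift_extendShift hη (θ := cokernel.π _ ≫ θ)
      (cokernel.condition_assoc _ _ |>.trans zero_comp)
    refine ⟨cokernel.desc _ _ h₂, ?_⟩
    rw [← cancel_epi (cokernel.π _), cokernel.π_desc_assoc, ← A.extendShift_comp,
      Category.assoc, hθ, cokernel.π_desc, A.extendShift_restrictShift]

end Projective

section Mono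

variable {k : Type u} [CommRing k]

lemma freeModule_map_injective {D : Type} [Category.{u} D] {x y z : D} {g : y ⟶ z}
    (hg : Function.Injective fun a : x ⟶ y => a ≫ g) :
    Function.Injective ((freeModule k x).map g) :=
  Finsupp.mapDomain_injective hg

lemma comp_injective_of_freeModule_map_injective [Nontrivial k] {D : Type} [Category.{u} D]
    {x y z : D} {g : y ⟶ z} (hg : Function.Injective ((freeModule k x).map g)) :
    Function.Injective fun a : x ⟶ y => a ≫ g := by
  intro a b h
  have h' : (freeModule k x).map g (freeModuleMk a) = (freeModule k x).map g (freeModuleMk b) := by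
    rw [freeModule_map_mk, freeModule_map_mk]
    exact congrArg freeModuleMk h
  exact Finsupp.single_left_injective one_ne_zero (hg h')

variable {ι : Type} [DecidableEq ι] {C : ι → Type} [∀ j, Category.{u} (C j)]
  {i : ι} {G : ∀ j, C j ⥤ C j} {η : ∀ j, 𝟭 (C j) ⟶ G j}

lemma mono_toShift_pi (hη : ∀ j, j ≠ i → IsIso (η j)) (x : ∀ j, C j)
    [Mono (toShift (η i) (freeModule k (x i)))] :
    Mono (toShift (piShift η) (freeModule k x)) := by
  rw [NatTrans.mono_iff_mono_app]
  intro l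
  rw [ModuleCat.mono_iff_injective]
  -- Recovering cancellation of morphisms from injectivity on basis elements requires 1 ≠ 0 in `k`.
  rcases subsingleton_or_nontrivial k with hk | hk
  · have := Module.subsingleton k ((freeModule k x).obj l)
    exact Function.injective_of_subsingleton _
  · refine freeModule_map_injective (g := (piShift η).app l) fun a b hab => piHom_ext i ?_ ?_
    · exact comp_injective_of_freeModule_map_injective (k := k)
        (app_injective_of_mono (toShift (η i) (freeModule k (x i))) (l i)) (congrFun hab i)
    · intro j hj
      have := hη j hj
      exact (cancel_mono ((η j).app (l j))).1 (congrFun hab j)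

end Mono

/-! ### Generic shifts give deriving shifts of the product. -/

section GenericShift

variable {k : Type u} [CommRing k]

lemma TransitiveTypeAInfinity.eq_of_hom {E : Type} [Category.{u} E] [TransitiveTypeAInfinity E]
    {a b : E} (f : a ⟶ b) (g : b ⟶ a) : a = b :=
  deg.injective (le_antisymm ((nonempty_hom_iff a b).1 ⟨f⟩) ((nonempty_hom_iff b a).1 ⟨g⟩))

lemma exists_comp_eq_of_eq {E : Type} [Category.{u} E] {a b c : E} (h : a = b) (f : a ⟶ c) :
    ∃ (p : a ⟶ b) (q : b ⟶ c), f = p ≫ q := by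
  subst h
  exact ⟨𝟙 _, f, (Category.id_comp f).symm⟩

lemma rank_le_homologicalDegree {D : Type} [Category.{u} D] [RankedCategory D] {s : ℕ}
    {V : D ⥤ ModuleCat.{u} k} {n : D} (h : ¬ HomologyVanishes s V n) :
    (rank n : EReal) ≤ homologicalDegree s V := by
  rw [homologyVanishes_iff, not_not] at h
  rw [homologicalDegree, if_pos ⟨n, h⟩]
  exact le_sSup ⟨n, h, rfl⟩

lemma decomposables_sup_range_eq_top {D : Type} [Category.{u} D] {F : D ⥤ D} (ε : 𝟭 D ⟶ F)
    (V : D ⥤ ModuleCat.{u} k) (n : D) (h : decomposables (cokernel (toShift ε V)) n = ⊤) :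
    decomposables (F ⋙ V) n ⊔ LinearMap.range (V.map (ε.app n)).hom = ⊤ := by
  rw [eq_top_iff]
  rintro (v : (F ⋙ V).obj n) -
  rw [decomposables_eq_map_of_epi (cokernel.π (toShift ε V)) n] at h
  obtain ⟨y, hy, hyv⟩ : (cokernel.π (toShift ε V)).app n v ∈ _ := h ▸ Submodule.mem_top
  obtain ⟨z, hz⟩ := exists_app_eq_of_exact (ShortComplex.exact_cokernel (toShift ε V)) n
    (v := v - y) (by rw [map_sub, sub_eq_zero]; exact hyv.symm)
  refine Submodule.mem_sup.2 ⟨y, hy, v - y, ⟨z, hz⟩, add_sub_cancel _ _⟩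

variable {m : ℕ} {C : Fin m → Type} [∀ j, Category.{u} (C j)] [∀ j, TransitiveTypeAInfinity (C j)]
  {i : Fin m} {G : ∀ j, C j ⥤ C j} {η : ∀ j, 𝟭 (C j) ⟶ G j}

lemma IsGenericShift.decomposables_sup_range {E : Type} [Category.{u} E]
    [TransitiveTypeAInfinity E] {ψ : E ⥤ E} {ε : 𝟭 E ⟶ ψ} (h : IsGenericShift k ψ ε) (n : E) :
    decomposables (ψ ⋙ freeModule k n) n ⊔
      LinearMap.range ((freeModule k n).map (ε.app n)).hom = ⊤ := by
  refine decomposables_sup_range_eq_top ε _ n ((homologyVanishes_zero_iff _ n).1 ?_)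
  -- The cokernel is generated in degrees at most n - 1, so its H_0 is already zero at n.
  by_contra hn
  have h1 := (rank_le_homologicalDegree hn).trans (h.generationDegree_le n)
  have h2 : ((deg n : ℝ) : EReal) ≤ ((deg n - 1 : ℝ) : EReal) := by
    push_cast
    exact h1
  rw [EReal.coe_le_coe_iff] at h2
  linarith

lemma CoordinateInclusion.functor_obj_injective {x : ∀ j, C j} (A : CoordinateInclusion i x) :
    Function.Injective A.functor.obj := by
  intro a b h
  have e : A.functor.obj a i = A.functor.obj b i := congrFun h i
  exact eq_of_hom (A.ofSelf a ≫ eqToHom e ≫ A.toSelf b) (A.ofSelf b ≫ eqToHom e.symm ≫ A.toSelf a)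

lemma decomposables_comp_le {D E : Type} [Category.{u} D] [Category.{u} E] (F : E ⥤ D)
    (hF : Function.Injective F.obj) (V : D ⥤ ModuleCat.{u} k) (n : E) :
    decomposables (F ⋙ V) n ≤ decomposables V (F.obj n) :=
  iSup_le fun _ => iSup_le fun hr => iSup_le fun f =>
    le_iSup_of_le _ (le_iSup_of_le (hF.ne hr) (le_iSup_of_le (F.map f) le_rfl))

/-- A basis element `b` is the image of its component `b i` under restriction to the coordinate line
followed by `A.rest hη b`; the one-variable identity is transported along this map. -/
lemma decomposables_sup_range_pi (h : IsGenericShift k (G i) (η i))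
    (hη : ∀ j, j ≠ i → IsIso (η j)) (x : ∀ j, C j) :
    decomposables (Functor.pi G ⋙ freeModule k x) x ⊔
      LinearMap.range ((freeModule k x).map ((piShift η).app x)).hom = ⊤ := by
  obtain ⟨A⟩ : Nonempty (CoordinateInclusion i x) := inferInstance
  set R := decomposables (Functor.pi G ⋙ freeModule k x) x ⊔
      LinearMap.range ((freeModule k x).map ((piShift η).app x)).hom with hR
  rw [eq_top_iff, ← span_freeModuleMk (k := k) x ((Functor.pi G).obj x), Submodule.span_le]
  rintro _ ⟨b, rfl⟩
  let θ := A.restrictShift (η := η) (𝟙 (Functor.pi G ⋙ freeModule k x))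
  let c : (A.functor ⋙ Functor.pi G ⋙ freeModule k x).obj (x i) ⟶
    (Functor.pi G ⋙ freeModule k x).obj x := (Functor.pi G ⋙ freeModule k x).map (A.rest hη b)
  have hb : (θ.app (x i) ≫ c) (freeModuleMk (b i)) = freeModuleMk b := by
    refine (congrArg c (A.restrictShift_mk _ _)).trans ?_
    refine (freeModule_map_mk _ _).trans ?_
    rw [A.extend_comp_map_rest]
  have key : ⊤ ≤ R.comap (θ.app (x i) ≫ c).hom := by
    rw [← h.decomposables_sup_range (x i)]
    refine sup_le ?_ ?_
    · refine (decomposables_le_comap_app θ (x i)).trans fun y hy => ?_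
      exact Submodule.mem_sup_left (decomposables_le_comap_map _ (A.rest hη b)
        (decomposables_comp_le A.functor A.functor_obj_injective _ _ hy))
    · rw [LinearMap.range_eq_map, ← span_freeModuleMk (k := k) (x i) (x i), Submodule.map_span,
        Submodule.span_le]
      rintro _ ⟨_, ⟨g, rfl⟩, rfl⟩
      refine Submodule.mem_sup_right
        ⟨freeModuleMk (piHom i (g ≫ A.ofSelf (x i)) (A.ofConst (x i)) ≫ A.rest hη b), ?_⟩
      refine (freeModule_map_mk _ _).trans ?_
      refine Eq.trans ?_ (congrArg (θ.app (x i) ≫ c) (freeModule_map_mk g ((η i).app (x i)))).symm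
      refine Eq.trans ?_ (congrArg c (A.restrictShift_mk _ _)).symm
      refine Eq.trans ?_ (freeModule_map_mk _ _).symm
      rw [A.extend_comp_app, Category.assoc, Category.assoc]
      exact congrArg (fun u => freeModuleMk (_ ≫ u)) ((piShift η).naturality (A.rest hη b))
  rw [← hb]
  exact key Submodule.mem_top

lemma deg_pi_self (h : IsGenericShift k (G i) (η i)) (x : ∀ j, C j) :
    deg ((Functor.pi G).obj x i) = deg (x i) + 1 := h.deg_obj (x i)

lemma pi_obj_of_ne (hη : ∀ j, j ≠ i → IsIso (η j)) (x : ∀ j, C j) {j : Fin m} (hj : j ≠ i) :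
    (Functor.pi G).obj x j = x j :=
  eq_of_hom (invShift hη j hj (x j)) ((η j).app (x j))

lemma ne_pi_obj (h : IsGenericShift k (G i) (η i)) (x : ∀ j, C j) :
    x ≠ (Functor.pi G).obj x := by
  intro e
  have e' := congrArg deg (congrFun e i)
  rw [deg_pi_self h] at e'
  exact Nat.ne_of_lt (Nat.lt_succ_self _) e'

section PiShift

variable (h : IsGenericShift k (G i) (η i)) (hη : ∀ j, j ≠ i → IsIso (η j))
include h hη

lemma pi_obj_injective : Function.Injective (Functor.pi G).obj := by
  intro x y e
  funext j
  have ej := congrFun e j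
  by_cases hj : j = i
  · subst hj
    have e' := congrArg deg ej
    rw [deg_pi_self h, deg_pi_self h, add_left_inj] at e'
    exact deg.injective e'
  · rwa [pi_obj_of_ne hη x hj, pi_obj_of_ne hη y hj] at ej

lemma decomposables_pi_eq (V : (∀ j, C j) ⥤ ModuleCat.{u} k) (n : ∀ j, C j) :
    decomposables V ((Functor.pi G).obj n) =
      decomposables (Functor.pi G ⋙ V) n ⊔ LinearMap.range (V.map ((piShift η).app n)).hom := by
  refine le_antisymm ?_ (sup_le (decomposables_comp_le _ (pi_obj_injective h hη) V n) ?_)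
  · refine iSup_le fun r => iSup_le fun hr => iSup_le fun f => ?_
    rintro _ ⟨v, rfl⟩
    -- If r_i ≤ n_i, then `f` passes through `n`, and the claim is the image of the universal one
    -- for the free module at `n`.
    by_cases hd : deg (r i) ≤ deg (n i)
    · obtain ⟨a, b, hab⟩ : ∃ (a : r i ⟶ n i) (b : n i ⟶ (G i).obj (n i)), f i = a ≫ b := by
        rcases hd.lt_or_eq with hd | hd
        · exact TransitiveTypeAInfinity.factors (r i) (n i) _ hd
            ((h.deg_obj (n i)).symm ▸ Nat.lt_succ_self _) (f i)
        · exact exists_comp_eq_of_eq (deg.injective hd) (f i)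
      let p : r ⟶ n := piHom i a fun j hj => f j ≫ invShift hη j hj (n j)
      let q : n ⟶ (Functor.pi G).obj n := piHom i b fun j _ => (η j).app (n j)
      have hpq : f = p ≫ q := by
        refine piHom_ext i ?_ fun j hj => ?_
        · have hp : p i = a := piHom_self (x := r) (y := n) i a _
          have hq : q i = b := piHom_self (x := n) (y := (Functor.pi G).obj n) i b _
          exact hab.trans (congrArg₂ (· ≫ ·) hp hq).symm
        · have hp : p j = f j ≫ invShift hη j hj (n j) := piHom_of_ne (x := r) (y := n) _ _ hj
          have hq : q j = (η j).app (n j) :=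
            piHom_of_ne (x := n) (y := (Functor.pi G).obj n) _ _ hj
          exact (comp_invShift_comp_app hη j hj (f j)).symm.trans (congrArg₂ (· ≫ ·) hp hq).symm
      rw [hpq, V.map_comp]
      change V.map q (V.map p v) ∈ _
      let χ := Functor.whiskerLeft (Functor.pi G) (freeModuleDesc (V.map p v))
      have hχ : χ.app n (freeModuleMk q) = V.map q (V.map p v) :=
        ModuleCat.freeDesc_apply _ _
      have key : ⊤ ≤ (decomposables (Functor.pi G ⋙ V) n ⊔
          LinearMap.range (V.map ((piShift η).app n)).hom).comap (χ.app n).hom := by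
        rw [← decomposables_sup_range_pi h hη n]
        refine sup_le ((decomposables_le_comap_app χ n).trans
          (Submodule.comap_mono le_sup_left)) ?_
        rintro _ ⟨z, rfl⟩
        refine Submodule.mem_sup_right ⟨(freeModuleDesc (V.map p v)).app n z, ?_⟩
        exact (ConcreteCategory.congr_hom
          ((freeModuleDesc (V.map p v)).naturality ((piShift η).app n)) z).symm
      rw [← hχ]
      exact key Submodule.mem_top
    -- Here r_i = n_i + 1, so `r` and the shift of `n` differ in another coordinate. Then `f` ends
    -- with the shift of a morphism into `n` from a different object, so its image is decomposable
    -- in the shifted module.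
    · obtain ⟨A⟩ : Nonempty (CoordinateInclusion i r) := inferInstance
      have hri : deg (r i) = deg (n i) + 1 := by
        have := (nonempty_hom_iff _ _).1 ⟨f i⟩
        rw [deg_pi_self h] at this
        omega
      have hA : A.functor.obj (n i) ≠ n := by
        intro e
        apply hr
        funext j
        by_cases hj : j = i
        · subst hj
          exact deg.injective (hri.trans (deg_pi_self h n).symm)
        · rw [pi_obj_of_ne hη n hj]
          have ej := congrFun e j
          exact eq_of_hom (A.ofConst (n i) j hj ≫ eqToHom ej)
            (eqToHom ej.symm ≫ A.toConst (n i) j hj)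
      obtain ⟨g, hg⟩ : ∃ g : r i ⟶ (G i).obj (n i), g = f i := ⟨f i, rfl⟩
      rw [← A.extend_comp_map_rest hη f, V.map_comp]
      refine Submodule.mem_sup_left (Submodule.mem_iSup_of_mem _ (Submodule.mem_iSup_of_mem hA
        (Submodule.mem_iSup_of_mem (A.rest hη f) ⟨V.map (A.extend η (f i)) v, ?_⟩)))
      rfl
  · exact le_iSup_of_le _ (le_iSup_of_le (ne_pi_obj h n)
      (le_iSup_of_le ((piShift η).app n) le_rfl))

theorem isDerivingShift_pi : IsDerivingShift k (piShift η) where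
  mono x := have := h.injective (x i); mono_toShift_pi hη x
  projective x := have := h.projective (x i); projective_cokernel_toShift_pi hη x
  decomposables_eq := decomposables_pi_eq h hη

lemma exists_eq_piShift_comp {r n : ∀ j, C j} (f : r ⟶ n) (hd : deg (r i) < deg (n i)) :
    ∃ g, f = (piShift η).app r ≫ g := by
  obtain ⟨g, hg⟩ : ∃ g : (G i).obj (r i) ⟶ n i, f i = (η i).app (r i) ≫ g := by
    have hr := h.deg_obj (r i)
    -- By transitivity any first step out of r_i is the shift map followed by an automorphism.
    have main : ∀ l : C i, deg l = deg (r i) + 1 → ∀ a b : r i ⟶ l, ∃ s, b = a ≫ s := fun l hl a b =>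
      have ⟨s, hs⟩ := TransitiveTypeAInfinity.transitive (r i) l (by omega) a b
      ⟨s.hom, hs.symm⟩
    rcases (show deg (r i) + 1 ≤ deg (n i) from hd).lt_or_eq with h1 | h1
    · obtain ⟨a, b, hab⟩ := TransitiveTypeAInfinity.factors (r i) ((G i).obj (r i)) (n i)
        (by omega) (by omega) (f i)
      obtain ⟨s, hs⟩ := main _ hr ((η i).app (r i)) a
      exact ⟨s ≫ b, by rw [hab, hs]; exact Category.assoc _ _ _⟩
    · have e : (G i).obj (r i) = n i := deg.injective (hr.trans h1)
      obtain ⟨s, hs⟩ := main _ hr ((η i).app (r i)) (f i ≫ eqToHom e.symm)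
      refine ⟨s ≫ eqToHom e, ?_⟩
      have := congrArg (fun u => u ≫ eqToHom e) hs
      simpa using this
  refine ⟨piHom i g fun j hj => invShift hη j hj (r j) ≫ f j, piHom_ext i ?_ fun j hj => ?_⟩
  · exact hg.trans (congrArg ((η i).app (r i) ≫ ·)
      (piHom_self (x := (Functor.pi G).obj r) (y := n) i g _)).symm
  · refine Eq.trans ?_ (congrArg ((η j).app (r j) ≫ ·)
      (piHom_of_ne (x := (Functor.pi G).obj r) (y := n) g _ hj)).symm
    refine Eq.trans ?_ (Category.assoc _ _ _)
    exact (Category.id_comp _).symm.trans (congrArg (fun u => u ≫ f j)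
      (app_invShift hη j hj (r j)).symm)

lemma exists_eq_pi_obj (n : ∀ j, C j) (hn : 0 < deg (n i)) : ∃ r, n = (Functor.pi G).obj r := by
  refine ⟨Function.update n i (deg.symm (deg (n i) - 1)), ?_⟩
  funext j
  by_cases hj : j = i
  · subst hj
    apply deg.injective
    rw [deg_pi_self h, Function.update_self, Equiv.apply_symm_apply]
    omega
  · rw [pi_obj_of_ne hη _ hj, Function.update_of_ne hj]

end PiShift

end GenericShift

/-! ### Nakayama's lemma and vanishing in large rank. -/

section Nakayama

variable {k : Type u} [CommRing k] {D : Type} [Category.{u} D]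

lemma subsingleton_kernel_obj {V W : D ⥤ ModuleCat.{u} k} (φ : V ⟶ W) {n : D}
    (h : Subsingleton (V.obj n)) : Subsingleton ((kernel φ).obj n) :=
  (app_injective_of_mono (kernel.ι φ) n).subsingleton

lemma subsingleton_cokernel_obj {V W : D ⥤ ModuleCat.{u} k} (φ : V ⟶ W) {n : D}
    (h : Subsingleton (W.obj n)) : Subsingleton ((cokernel φ).obj n) :=
  (app_surjective_of_epi (cokernel.π φ) n).subsingleton

variable [RankedCategory D]

/-- `H_s(V)_n = 0` for all `n` with `c ≤ |n|`. -/
def HomologyVanishesFrom (s : ℕ) (V : D ⥤ ModuleCat.{u} k) (c : ℕ) : Prop :=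
  ∀ n, c ≤ rank n → HomologyVanishes s V n

/-- The submodule of `V_n` generated by the `V_r` with `|r| < c`. -/
def spanOfRankLT (V : D ⥤ ModuleCat.{u} k) (c : ℕ) (n : D) : Submodule k (V.obj n) :=
  ⨆ (r : D) (_ : rank r < c) (f : r ⟶ n), LinearMap.range (V.map f).hom

lemma range_le_spanOfRankLT (V : D ⥤ ModuleCat.{u} k) {c : ℕ} {r n : D} (h : rank r < c)
    (f : r ⟶ n) : LinearMap.range (V.map f).hom ≤ spanOfRankLT V c n :=
  le_iSup_of_le r (le_iSup_of_le h (le_iSup_of_le f le_rfl))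

lemma map_spanOfRankLT_le (V : D ⥤ ModuleCat.{u} k) (c : ℕ) {r n : D} (f : r ⟶ n) :
    (spanOfRankLT V c r).map (V.map f).hom ≤ spanOfRankLT V c n := by
  rw [Submodule.map_le_iff_le_comap]
  refine iSup_le fun x => iSup_le fun hx => iSup_le fun g => ?_
  rintro _ ⟨v, rfl⟩
  refine range_le_spanOfRankLT V hx (g ≫ f) ⟨v, ?_⟩
  simp

/-- A form of Nakayama's lemma. -/
lemma HomologyVanishesFrom.spanOfRankLT_eq_top {V : D ⥤ ModuleCat.{u} k} {c : ℕ}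
    (h : HomologyVanishesFrom 0 V c) (n : D) : spanOfRankLT V c n = ⊤ := by
  induction hN : rank n using Nat.strong_induction_on generalizing n with
  | _ N ih =>
    subst hN
    by_cases hn : rank n < c
    · refine eq_top_iff.2 fun v _ => range_le_spanOfRankLT V hn (𝟙 n) ⟨v, ?_⟩
      simp
    · rw [eq_top_iff, ← (homologyVanishes_zero_iff V n).1 (h n (not_lt.1 hn))]
      refine iSup_le fun r => iSup_le fun hr => iSup_le fun f => ?_
      rw [LinearMap.range_eq_map, ← ih _ (rank_lt f hr) r rfl]
      exact map_spanOfRankLT_le V c f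

lemma HomologyVanishesFrom.subsingleton {V : D ⥤ ModuleCat.{u} k}
    (h : HomologyVanishesFrom 0 V 0) (n : D) : Subsingleton (V.obj n) := by
  rw [← Submodule.subsingleton_iff k, ← subsingleton_iff_bot_eq_top,
    ← h.spanOfRankLT_eq_top n, eq_comm]
  simp [spanOfRankLT]

lemma homologyVanishes_of_subsingleton {V : D ⥤ ModuleCat.{u} k}
    (h : ∀ n, Subsingleton (V.obj n)) (s : ℕ) (n : D) : HomologyVanishes s V n := by
  obtain _ | s := s
  · have := h n
    exact (homologyVanishes_zero_iff V n).2 (Subsingleton.elim _ _)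
  · have : Projective V :=
      (Functor.isZero _ fun _ => ModuleCat.isZero_iff_subsingleton.2 (h _)).projective
    exact Functor.isZero_leftDerived_obj_projective_succ _ s V

end Nakayama

/-! ### Bounding homological degrees by induction. -/

section CoordinateShifts

/-- A ranked category whose objects have `m` coordinates, with a shift in each of them. -/
structure CoordinateShifts (k : Type u) [CommRing k] (m : ℕ) (D : Type) [Category.{u} D]
    [RankedCategory D] where
  coord : D → Fin m → ℕ
  shift : Fin m → D ⥤ D
  toShifted (i : Fin m) : 𝟭 D ⟶ shift i
  isDerivingShift (i : Fin m) : IsDerivingShift k (toShifted i)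
  rank_eq (n : D) : rank n = ∑ i, coord n i
  coord_self (i : Fin m) (n : D) : coord ((shift i).obj n) i = coord n i + 1
  coord_ne {i j : Fin m} (h : j ≠ i) (n : D) : coord ((shift i).obj n) j = coord n j
  exists_eq_obj (i : Fin m) (n : D) (h : 0 < coord n i) : ∃ r, n = (shift i).obj r
  exists_eq_comp (i : Fin m) {r n : D} (f : r ⟶ n) (h : coord r i < coord n i) :
    ∃ g, f = (toShifted i).app r ≫ g

namespace CoordinateShifts

variable {k : Type u} [CommRing k] {m : ℕ} {D : Type} [Category.{u} D] [RankedCategory D]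
  (A : CoordinateShifts k m D)

lemma rank_obj (i : Fin m) (n : D) : rank ((A.shift i).obj n) = rank n + 1 := by
  rw [A.rank_eq, A.rank_eq, ← Finset.add_sum_erase _ _ (Finset.mem_univ i),
    ← Finset.add_sum_erase _ (fun j => A.coord n j) (Finset.mem_univ i),
    A.coord_self,
    Finset.sum_congr rfl (g := fun j => A.coord n j)
      fun j hj => A.coord_ne (Finset.ne_of_mem_erase hj) n]
  omega

lemma coord_le_rank (i : Fin m) (n : D) : A.coord n i ≤ rank n := by
  rw [A.rank_eq]
  exact Finset.single_le_sum (fun _ _ => Nat.zero_le _) (Finset.mem_univ i)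

lemma coord_le (i j : Fin m) (n : D) : A.coord n j ≤ A.coord ((A.shift i).obj n) j := by
  by_cases h : j = i
  · subst h
    rw [A.coord_self]
    omega
  · rw [A.coord_ne h]

lemma sum_obj {S : Finset (Fin m)} {i : Fin m} (hi : i ∈ S) (n : D) :
    ∑ j ∈ S, A.coord ((A.shift i).obj n) j = ∑ j ∈ S, A.coord n j + 1 := by
  rw [← Finset.add_sum_erase _ _ hi, ← Finset.add_sum_erase _ (fun j => A.coord n j) hi, A.coord_self,
    Finset.sum_congr rfl (g := fun j => A.coord n j)
      fun j hj => A.coord_ne (Finset.ne_of_mem_erase hj) n]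
  omega

/-- The kernel of `V ⟶ V ∘ F_i`. -/
abbrev ker (i : Fin m) (V : D ⥤ ModuleCat.{u} k) : D ⥤ ModuleCat.{u} k :=
  kernel (toShift (A.toShifted i) V)

/-- The cokernel of `V ⟶ V ∘ F_i`. -/
abbrev derived (i : Fin m) (V : D ⥤ ModuleCat.{u} k) : D ⥤ ModuleCat.{u} k :=
  cokernel (toShift (A.toShifted i) V)

/-- `V` vanishes at the objects whose coordinates in `S` have sum at least `t`. -/
def SupportedBelow (S : Finset (Fin m)) (t : ℕ) (V : D ⥤ ModuleCat.{u} k) : Prop :=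
  ∀ n, t ≤ ∑ j ∈ S, A.coord n j → Subsingleton (V.obj n)

variable {A}

lemma homologyVanishesFrom_zero_derived {V : D ⥤ ModuleCat.{u} k} {d : ℕ}
    (h : HomologyVanishesFrom 0 V (d + 1)) (i : Fin m) :
    HomologyVanishesFrom 0 (A.derived i V) d := fun n hn =>
  (homologyVanishes_zero_shiftCokernel_iff (A.isDerivingShift i) V n).2
    (h _ (by rw [A.rank_obj]; omega))

lemma homologyVanishesFrom_one_derived {V : D ⥤ ModuleCat.{u} k} {d : ℕ}
    (h : HomologyVanishesFrom 1 V d) (i : Fin m) :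
    HomologyVanishesFrom 1 (A.derived i V) d := fun n hn =>
  (A.isDerivingShift i).homologyVanishes_one_shiftCokernel V n
    (h _ (by rw [A.rank_obj]; omega))

/-- The sum `c + d` serves only as a common upper bound of the two thresholds. -/
lemma homologyVanishesFrom_ker {V : D ⥤ ModuleCat.{u} k} {i : Fin m} {s c d : ℕ}
    (h₁ : HomologyVanishesFrom (s + 2) (A.derived i V) c)
    (h₂ : HomologyVanishesFrom (s + 1) V d) : HomologyVanishesFrom s (A.ker i V) (c + d) :=
  fun n hn => (A.isDerivingShift i).homologyVanishes_kernel s V n (h₁ n (by omega))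
    (h₂ _ (by rw [A.rank_obj]; omega))

lemma ker_map_toShifted (i : Fin m) (V : D ⥤ ModuleCat.{u} k) (n : D) :
    (A.ker i V).map ((A.toShifted i).app n) = 0 := by
  rw [← cancel_mono ((kernel.ι (toShift (A.toShifted i) V)).app _), zero_comp]
  refine ((kernel.ι (toShift (A.toShifted i) V)).naturality _).trans ?_
  exact congrArg (fun φ => NatTrans.app φ n) (kernel.condition (toShift (A.toShifted i) V))

/-- A generator of rank below `c` has i-th coordinate below `c`. A morphism from it to an object
with coordinate at least `c` factors through the shift map, which acts as zero on the kernel. -/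
lemma supportedBelow_ker {V : D ⥤ ModuleCat.{u} k} {i : Fin m} {c : ℕ}
    (h : HomologyVanishesFrom 0 (A.ker i V) c) : A.SupportedBelow {i} c (A.ker i V) := by
  intro n hn
  rw [Finset.sum_singleton] at hn
  rw [← Submodule.subsingleton_iff k, ← subsingleton_iff_bot_eq_top, eq_comm, eq_bot_iff,
    ← h.spanOfRankLT_eq_top n]
  refine iSup_le fun r => iSup_le fun hr => iSup_le fun f => ?_
  obtain ⟨g, rfl⟩ := A.exists_eq_comp i f
    (((A.coord_le_rank i r).trans_lt hr).trans_le hn)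
  rw [Functor.map_comp, ker_map_toShifted, zero_comp]
  rintro _ ⟨v, rfl⟩
  rfl

lemma SupportedBelow.ker {S : Finset (Fin m)} {t : ℕ} {V : D ⥤ ModuleCat.{u} k}
    (h : A.SupportedBelow S t V) (i : Fin m) : A.SupportedBelow S t (A.ker i V) :=
  fun n hn => subsingleton_kernel_obj _ (h n hn)

lemma SupportedBelow.derived {S : Finset (Fin m)} {t : ℕ} {V : D ⥤ ModuleCat.{u} k}
    (h : A.SupportedBelow S t V) (i : Fin m) : A.SupportedBelow S t (A.derived i V) :=
  fun n hn => subsingleton_cokernel_obj _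
    (h _ (hn.trans (Finset.sum_le_sum fun j _ => A.coord_le i j n)))

lemma SupportedBelow.derived_of_mem {S : Finset (Fin m)} {t : ℕ} {V : D ⥤ ModuleCat.{u} k}
    (h : A.SupportedBelow S (t + 1) V) {i : Fin m} (hi : i ∈ S) :
    A.SupportedBelow S t (A.derived i V) :=
  fun n hn => subsingleton_cokernel_obj _ (h _ (by rw [A.sum_obj hi]; omega))

/-- Shifting back along some i in `S` lowers the coordinate sum by one. This is paid for by the
homological degree for the kernel, and by the support bound `t` for the cokernel. -/
lemma SupportedBelow.homologyVanishes {S : Finset (Fin m)} {t : ℕ} {V : D ⥤ ModuleCat.{u} k}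
    (h : A.SupportedBelow S t V) (s : ℕ) (n : D) (hn : t + s ≤ ∑ j ∈ S, A.coord n j) :
    HomologyVanishes s V n := by
  induction t generalizing s V n with
  | zero => exact homologyVanishes_of_subsingleton (fun n => h n (Nat.zero_le _)) s n
  | succ t iht =>
    induction s generalizing V n with
    | zero =>
      rw [homologyVanishes_zero_iff]
      have := h n hn
      exact Subsingleton.elim _ _
    | succ s ihs =>
      obtain ⟨i, hi, hi'⟩ : ∃ i ∈ S, 0 < A.coord n i := by
        by_contra! hc
        have := Finset.sum_eq_zero fun i hi => Nat.le_zero.1 (hc i hi)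
        omega
      obtain ⟨r, rfl⟩ := A.exists_eq_obj i n hi'
      rw [A.sum_obj hi] at hn
      exact (A.isDerivingShift i).homologyVanishes_succ s V r (ihs (h.ker i) r (by omega))
        (iht (h.derived_of_mem hi) (s + 1) r (by omega))

/-- The cokernels have smaller generation degree, and the kernels have support bounded in one
coordinate. The bound depends on `s` without control; it is used below to get hd_2(V), hence hd_1 of
the kernels. -/
theorem exists_homologyVanishesFrom (A : CoordinateShifts k m D)
    {V : D ⥤ ModuleCat.{u} k} {d c : ℕ} (h₀ : HomologyVanishesFrom 0 V d) (h₁ : HomologyVanishesFrom 1 V c) (s : ℕ) :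
    ∃ b, HomologyVanishesFrom s V b := by
  induction d generalizing V s with
  | zero => exact ⟨0, fun n _ => homologyVanishes_of_subsingleton h₀.subsingleton s n⟩
  | succ d ih =>
    obtain _ | s := s
    · exact ⟨_, h₀⟩
    have hD : ∀ i s, ∃ b, HomologyVanishesFrom s (A.derived i V) b := fun i s =>
      ih (homologyVanishesFrom_zero_derived h₀ i) (homologyVanishesFrom_one_derived h₁ i) s
    choose b hb using hD
    -- Beyond the sum, some coordinate i exceeds its own summand. There `b i 2 + c` bounds the
    -- support of the kernel, `s` is the cost of its H_s, and `b i (s + 1)` handles the cokernel.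
    refine ⟨∑ i, (b i 2 + c + s + 1 + b i (s + 1)) + 1, fun n hn => ?_⟩
    rw [A.rank_eq, Nat.add_one_le_iff] at hn
    obtain ⟨i, -, hi⟩ := Finset.exists_lt_of_sum_lt hn
    obtain ⟨r, rfl⟩ := A.exists_eq_obj i n (by omega)
    rw [A.coord_self] at hi
    have hr := A.coord_le_rank i r
    refine (A.isDerivingShift i).homologyVanishes_succ s V r ?_ (hb i (s + 1) r (by omega))
    refine (supportedBelow_ker (homologyVanishesFrom_ker (hb i 2) h₁)).homologyVanishes s r ?_
    rw [Finset.sum_singleton]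
    omega

theorem exists_forall_homologyVanishesFrom_of_supportedBelow
    (A : CoordinateShifts k m D) {S : Finset (Fin m)} {t : ℕ} {V : D ⥤ ModuleCat.{u} k} {d c : ℕ} (hS : A.SupportedBelow S t V)
    (h₀ : HomologyVanishesFrom 0 V d) (h₁ : HomologyVanishesFrom 1 V c) :
    ∃ b, ∀ s, HomologyVanishesFrom s V (b + s) := by
  induction hj : Sᶜ.card using Nat.strong_induction_on generalizing S t V d c with
  | _ j ihS =>
    induction d generalizing V c with
    | zero => exact ⟨0, fun s n _ => homologyVanishes_of_subsingleton h₀.subsingleton s n⟩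
    | succ d ihd =>
      have hD₀ := fun i => homologyVanishesFrom_zero_derived (A := A) h₀ i
      have hD₁ := fun i => homologyVanishesFrom_one_derived (A := A) h₁ i
      have hD := fun i => ihd (hS.derived i) (hD₀ i) (hD₁ i)
      choose a ha using hD
      have hK : ∀ i, ∃ b, i ∉ S → ∀ s, HomologyVanishesFrom s (A.ker i V) (b + s) := by
        intro i
        by_cases hi : i ∈ S
        · exact ⟨0, fun h => absurd hi h⟩
        obtain ⟨p, hp⟩ := A.exists_homologyVanishesFrom h₀ h₁ 2
        have hK₀ := homologyVanishesFrom_ker (ha i 2) h₁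
        have hK₁ := homologyVanishesFrom_ker (ha i 3) hp
        have hsupp : A.SupportedBelow (insert i S) (t + (a i + 2 + c)) (A.ker i V) := by
          intro n hn
          rw [Finset.sum_insert hi] at hn
          rcases le_or_gt t (∑ j ∈ S, A.coord n j) with h | h
          · exact hS.ker i n h
          · exact supportedBelow_ker hK₀ n (by rw [Finset.sum_singleton]; omega)
        have hlt : (insert i S)ᶜ.card < j := by
          rw [← hj]
          refine Finset.card_lt_card (Finset.compl_ssubset_compl.2 (Finset.ssubset_insert hi))
        obtain ⟨b, hb⟩ := ihS _ hlt hsupp hK₀ hK₁ rfl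
        exact ⟨b, fun _ => hb⟩
      choose b hb using hK
      refine ⟨d + 1 + t + ∑ i, (a i + b i + 1), fun s n hn => ?_⟩
      obtain _ | s := s
      · exact h₀ n (by omega)
      by_cases hex : ∃ i ∉ S, 0 < A.coord n i
      · obtain ⟨i, hi, hi'⟩ := hex
        obtain ⟨r, rfl⟩ := A.exists_eq_obj i n hi'
        rw [A.rank_obj] at hn
        have hle : a i + b i + 1 ≤ ∑ i, (a i + b i + 1) :=
          Finset.single_le_sum (f := fun i => a i + b i + 1) (fun _ _ => Nat.zero_le _)
            (Finset.mem_univ i)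
        exact (A.isDerivingShift i).homologyVanishes_succ s V r (hb i hi s r (by omega))
          (ha i (s + 1) r (by omega))
      -- All coordinates outside `S` are 0, so the rank is the sum over `S` and the support
      -- condition suffices.
      · push Not at hex
        refine hS.homologyVanishes (s + 1) n ?_
        rw [A.rank_eq, ← Finset.sum_subset (Finset.subset_univ S)
          fun i _ hi => Nat.le_zero.1 (hex i hi)] at hn
        omega

/-- Bounded generation and relation degrees imply finite regularity. -/
theorem exists_forall_homologyVanishesFrom (A : CoordinateShifts k m D)
    {V : D ⥤ ModuleCat.{u} k} {d c : ℕ} (h₀ : HomologyVanishesFrom 0 V d) (h₁ : HomologyVanishesFrom 1 V c) :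
    ∃ b, ∀ s, HomologyVanishesFrom s V (b + s) := by
  -- The empty sum is 0 < 1, so the support condition holds vacuously for every module.
  refine A.exists_forall_homologyVanishesFrom_of_supportedBelow (S := ∅) (t := 1) ?_ h₀ h₁
  intro n hn
  simp at hn

end CoordinateShifts

end CoordinateShifts

/-! ### Presentation in finite degrees in terms of H_0 and H_1. -/

section Presentation

variable {k : Type u} [CommRing k] {D : Type} [Category.{u} D]

lemma shortExact_kernel {V W : D ⥤ ModuleCat.{u} k} (φ : V ⟶ W) [Epi φ] :
    (ShortComplex.mk (kernel.ι φ) φ (kernel.condition φ)).ShortExact where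
  exact := ShortComplex.exact_kernel φ

variable [RankedCategory D]

lemma homologyVanishesFrom_coproduct {I : Type u} {x : I → D} {c : ℕ} (h : ∀ i, rank (x i) < c) :
    HomologyVanishesFrom 0 (∐ fun i => freeModule k (x i)) c := by
  intro n hn
  rw [homologyVanishes_zero_iff, eq_top_iff]
  set P := ∐ fun i => freeModule k (x i)
  have key : ModuleCat.ofHom (decomposables P n).mkQ = 0 := by
    refine (isColimitOfPreserves ((evaluation D (ModuleCat.{u} k)).obj n)
      (coproductIsCoproduct fun i => freeModule k (x i))).hom_ext ?_
    rintro ⟨i⟩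
    refine freeModule_obj_hom_ext fun a => ?_
    refine (Submodule.Quotient.mk_eq_zero _).2 ?_
    have hi : x i ≠ n := fun e => absurd (h i) (by rw [e]; omega)
    refine Submodule.mem_iSup_of_mem (x i) (Submodule.mem_iSup_of_mem hi
      (Submodule.mem_iSup_of_mem a
        ⟨(Sigma.ι (fun i => freeModule k (x i)) i).app (x i) (freeModuleMk (𝟙 _)), ?_⟩))
    refine (ConcreteCategory.congr_hom
      ((Sigma.ι (fun i => freeModule k (x i)) i).naturality a) (freeModuleMk (𝟙 _))).symm.trans ?_
    exact congrArg ((Sigma.ι (fun i => freeModule k (x i)) i).app n) (freeModule_map_id a)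
  intro v _
  exact (Submodule.Quotient.mk_eq_zero _).1 (ConcreteCategory.congr_hom key v)

lemma HomologyVanishesFrom.of_epi {V W : D ⥤ ModuleCat.{u} k} {c : ℕ}
    (h : HomologyVanishesFrom 0 V c) (φ : V ⟶ W) [Epi φ] : HomologyVanishesFrom 0 W c := by
  intro n hn
  rw [homologyVanishes_zero_iff, decomposables_eq_map_of_epi φ n,
    (homologyVanishes_zero_iff V n).1 (h n hn), ← LinearMap.range_eq_map]
  exact LinearMap.range_eq_top.2 (app_surjective_of_epi φ n)

/-- A cover by free modules at objects of bounded rank. -/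
lemma HomologyVanishesFrom.exists_cover {V : D ⥤ ModuleCat.{u} k} {c : ℕ}
    (h : HomologyVanishesFrom 0 V c) :
    ∃ (I : Type u) (x : I → D) (π : (∐ fun i => freeModule k (x i)) ⟶ V),
      (∀ i, rank (x i) < c) ∧ Epi π := by
  let M (a : Σ x : {x : D // rank x < c}, V.obj x) : D ⥤ ModuleCat.{u} k := freeModule k a.1.1
  let f (a : Σ x : {x : D // rank x < c}, V.obj x) : M a ⟶ V := freeModuleDesc a.2
  refine ⟨_, fun a : Σ x : {x : D // rank x < c}, V.obj x => a.1.1, Sigma.desc f,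
    fun a => a.1.2, ?_⟩
  rw [NatTrans.epi_iff_epi_app]
  intro n
  rw [ModuleCat.epi_iff_surjective]
  refine LinearMap.range_eq_top.1 (eq_top_iff.2 ?_)
  rw [← h.spanOfRankLT_eq_top n]
  refine iSup_le fun r => iSup_le fun hr => iSup_le fun g => ?_
  rintro _ ⟨v, rfl⟩
  have hv : (Sigma.desc f).app r ((Sigma.ι M ⟨⟨r, hr⟩, v⟩).app r
      (freeModuleMk (𝟙 r))) = v := by
    rw [← ConcreteCategory.comp_apply, ← NatTrans.comp_app, Sigma.ι_desc]
    exact freeModuleDesc_app_id v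
  refine ⟨(∐ M).map g
    ((Sigma.ι M ⟨⟨r, hr⟩, v⟩).app r (freeModuleMk (𝟙 r))), ?_⟩
  refine (ConcreteCategory.congr_hom ((Sigma.desc f).naturality g) _).trans ?_
  exact congrArg (V.map g) hv

lemma generatedInFiniteDegrees_iff (V : D ⥤ ModuleCat.{u} k) :
    GeneratedInFiniteDegrees V ↔ ∃ c, HomologyVanishesFrom 0 V c := by
  refine ⟨fun ⟨N, I, x, π, hx, _⟩ => ⟨N, (homologyVanishesFrom_coproduct hx).of_epi π⟩,
    fun ⟨c, h⟩ => ?_⟩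
  obtain ⟨I, x, π, hx, hπ⟩ := h.exists_cover
  exact ⟨c, I, x, π, hx, hπ⟩

/-- A module is presented in finite degrees if and only if its first two homological degrees are
finite. -/
lemma presentedInFiniteDegrees_iff (V : D ⥤ ModuleCat.{u} k) :
    PresentedInFiniteDegrees V ↔
      (∃ c, HomologyVanishesFrom 0 V c) ∧ ∃ c, HomologyVanishesFrom 1 V c := by
  constructor
  · rintro ⟨I, x, π, hπ, hV, hK⟩
    refine ⟨(generatedInFiniteDegrees_iff V).1 hV, ?_⟩
    obtain ⟨c, hc⟩ := (generatedInFiniteDegrees_iff _).1 hK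
    refine ⟨c, fun n hn => ?_⟩
    have : Projective (ShortComplex.mk (kernel.ι π) π (kernel.condition π)).X₂ :=
      inferInstanceAs (Projective (∐ fun i => freeModule k (x i)))
    -- The ranks of the `x i` may be unbounded; H_1(V) embeds into H_0 of the kernel, which vanishes
    -- in large rank.
    refine (homologyVanishes_one_iff (shortExact_kernel π) n).2 ?_
    exact mono_of_isZero_moduleCat _ ((homologyVanishes_zero_iff_isZero _ n).1 (hc n hn))
  · rintro ⟨⟨c, hc⟩, d, hd⟩
    obtain ⟨I, x, π, hx, hπ⟩ := hc.exists_cover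
    refine ⟨I, x, π, hπ, (generatedInFiniteDegrees_iff V).2 ⟨c, hc⟩,
      (generatedInFiniteDegrees_iff _).2 ⟨c + d, fun n hn => ?_⟩⟩
    have := mono_of_homologyVanishes_one (shortExact_kernel π) n (hd n (by omega))
    have hP := (homologyVanishes_zero_iff_isZero _ n).1
      (homologyVanishesFrom_coproduct (k := k) hx n (by omega))
    exact (homologyVanishes_zero_iff_isZero _ n).2
      (hP.of_mono ((zerothHomologyAt k n).map (kernel.ι π)))

end Presentation

/-! ### Finite regularity as a linear vanishing bound. -/

section Regularity

variable {k : Type u} [CommRing k] {D : Type} [Category.{u} D] [RankedCategory D]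

lemma homologicalDegree_le {s : ℕ} {V : D ⥤ ModuleCat.{u} k} {c : ℕ}
    (h : HomologyVanishesFrom s V c) : homologicalDegree s V ≤ (c : EReal) := by
  unfold homologicalDegree
  split_ifs
  · refine sSup_le ?_
    rintro _ ⟨n, hn, rfl⟩
    by_contra hc
    rw [not_le, Nat.cast_lt] at hc
    exact (homologyVanishes_iff s V n).1 (h n hc.le) hn
  · exact (EReal.neg_le_zero.2 zero_le_one).trans (EReal.coe_nonneg.2 (Nat.cast_nonneg c))

lemma neg_one_le_homologicalDegree (s : ℕ) (V : D ⥤ ModuleCat.{u} k) :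
    -1 ≤ homologicalDegree s V := by
  by_cases h : ∃ n, ¬ HomologyVanishes s V n
  · obtain ⟨n, hn⟩ := h
    exact (EReal.neg_le_zero.2 zero_le_one).trans
      ((EReal.coe_nonneg.2 (Nat.cast_nonneg (rank n))).trans (rank_le_homologicalDegree hn))
  · push Not at h
    refine (if_neg ?_).ge
    rintro ⟨n, hn⟩
    exact (homologyVanishes_iff s V n).1 (h n) hn

lemma regularity_ne_bot (V : D ⥤ ModuleCat.{u} k) : regularity V ≠ ⊥ := by
  have h1 : homologicalDegree 0 V - ((0 : ℕ) : EReal) ≤ regularity V :=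
    le_iSup (fun s : ℕ => homologicalDegree s V - (s : EReal)) 0
  rw [Nat.cast_zero, sub_zero] at h1
  intro h
  have h2 := (neg_one_le_homologicalDegree 0 V).trans h1
  rw [h, le_bot_iff] at h2
  exact absurd h2 (EReal.coe_ne_bot (-1))

lemma regularity_ne_top_iff (V : D ⥤ ModuleCat.{u} k) :
    regularity V ≠ ⊤ ↔ ∃ b, ∀ s, HomologyVanishesFrom s V (b + s) := by
  constructor
  · intro h
    obtain ⟨r, hr, -⟩ := EReal.lt_iff_exists_real_btwn.1 (lt_top_iff_ne_top.2 h)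
    obtain ⟨b, hb⟩ := exists_nat_gt r
    refine ⟨b, fun s n hn => ?_⟩
    by_contra hs
    have h1 := (le_iSup (fun s : ℕ => homologicalDegree s V - (s : EReal)) s).trans hr.le
    have h2 := (rank_le_homologicalDegree hs).trans ((EReal.sub_le_iff_le_add (Or.inl
      (EReal.natCast_ne_bot s)) (Or.inl (EReal.natCast_ne_top s))).1 h1)
    have h3 : ((rank n : ℝ) : EReal) ≤ ((r + s : ℝ) : EReal) := by
      push_cast
      exact h2
    rw [EReal.coe_le_coe_iff] at h3
    have h4 : ((b + s : ℕ) : ℝ) ≤ rank n := Nat.cast_le.2 hn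
    push_cast at h4
    linarith
  · rintro ⟨b, hb⟩
    refine ne_top_of_le_ne_top (EReal.natCast_ne_top b) (iSup_le fun s => ?_)
    refine (EReal.sub_le_iff_le_add (Or.inl (EReal.natCast_ne_bot s))
      (Or.inl (EReal.natCast_ne_top s))).2 ?_
    exact_mod_cast homologicalDegree_le (hb s)

end Regularity

/-! ### The product category and the theorem. -/

section Product

variable {k : Type u} [CommRing k] {m : ℕ} {C : Fin m → Type} [∀ i, Category.{u} (C i)]
  [∀ i, TransitiveTypeAInfinity (C i)] {ψ : ∀ i, C i ⥤ C i} {ε : ∀ i, 𝟭 (C i) ⟶ ψ i}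

lemma exists_shift_in_coordinate (h : ∀ i, IsGenericShift k (ψ i) (ε i)) (i : Fin m) :
    ∃ (G : ∀ j, C j ⥤ C j) (η : ∀ j, 𝟭 (C j) ⟶ G j),
      IsGenericShift k (G i) (η i) ∧ ∀ j, j ≠ i → IsIso (η j) := by
  -- Pairing functor and transformation lets both be rewritten at once, without transport between
  -- functors.
  let p (j : Fin m) : Σ F : C j ⥤ C j, (𝟭 (C j) ⟶ F) :=
    if j = i then ⟨ψ j, ε j⟩ else ⟨𝟭 _, 𝟙 _⟩
  refine ⟨fun j => (p j).1, fun j => (p j).2, ?_, fun j hj => ?_⟩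
  · have : p i = ⟨ψ i, ε i⟩ := if_pos rfl
    change IsGenericShift k (p i).1 (p i).2
    rw [this]
    exact h i
  · have : p j = ⟨𝟭 _, 𝟙 _⟩ := if_neg hj
    change IsIso (p j).2
    rw [this]
    infer_instance

/-- The shifts of the factors give the shifts of the product in its coordinates. -/
def coordinateShifts (h : ∀ i, IsGenericShift k (ψ i) (ε i)) :
    CoordinateShifts k m (∀ i, C i) :=
  have hG := exists_shift_in_coordinate h
  { coord n i := deg (n i)
    shift i := Functor.pi (hG i).choose
    toShifted i := piShift (hG i).choose_spec.choose
    isDerivingShift i := isDerivingShift_pi (hG i).choose_spec.choose_spec.1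
      (hG i).choose_spec.choose_spec.2
    rank_eq _ := rfl
    coord_self i n := deg_pi_self (hG i).choose_spec.choose_spec.1 n
    coord_ne {i _} hj n := congrArg deg (pi_obj_of_ne (hG i).choose_spec.choose_spec.2 n hj)
    exists_eq_obj i n := exists_eq_pi_obj (hG i).choose_spec.choose_spec.1
      (hG i).choose_spec.choose_spec.2 n
    exists_eq_comp i _ _ f := exists_eq_piShift_comp (hG i).choose_spec.choose_spec.1
      (hG i).choose_spec.choose_spec.2 f }

end Product

theorem mainTheorem1 (k : Type u) [CommRing k] (m : ℕ) (C : Fin m → Type)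
    [∀ i, Category.{u} (C i)] [∀ i, TransitiveTypeAInfinity (C i)]
    (ψ : ∀ i, C i ⥤ C i) (ε : ∀ i, 𝟭 (C i) ⟶ ψ i) (_hψ : ∀ i, IsGenericShift k (ψ i) (ε i))
    (V : (∀ i, C i) ⥤ ModuleCat.{u} k) :
    (regularity V ≠ ⊥ ∧ regularity V ≠ ⊤) ↔ PresentedInFiniteDegrees V := by
  rw [regularity_ne_top_iff, presentedInFiniteDegrees_iff]
  constructor
  · rintro ⟨-, b, hb⟩
    exact ⟨⟨_, hb 0⟩, _, hb 1⟩
  · rintro ⟨⟨d, hd⟩, c, hc⟩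
    exact ⟨regularity_ne_bot V, (coordinateShifts _hψ).exists_forall_homologyVanishesFrom hd hc⟩
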